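/- Let $\mathbb F=\mathbb Q(q,t)$ with independent parameters $q,t$, and let $\Lambda$ be the $\mathbb F$-algebra of symmetric functions in infinitely many variables $x_1,x_2,\dots$, with power sums $p_n$, $n\ge1$, and elementary functions $e_n$. Put $E(z)=\sum_{n\ge0}e_nz^n$, define $H(z)$ by $E(-z)H(z)=1$, and let $$Q(z)=E(-tz)H(z)=\sum_{n\ge0}Q_nz^n .$$ For $k\ge0$ let $$F(z_1,\dots,z_k)=\prod_{1\le i<j\le k}\frac{z_i-z_j}{z_i-t\,z_j},$$ every factor being expanded as a power series in $z_j/z_i$. For a partition $\lambda=(\lambda_1\ge\dots\ge\lambda_k>0)$ of length $\ell(\lambda)=k$, with $k_i$ parts equal to $i$, let the Hall--Littlewood function $Q_\lambda$ be the coefficient at $z_1^{\lambda_1}\cdots z_k^{\lambda_k}$ of $Q(z_1)\cdots Q(z_k)F(z_1,\dots,z_k)$, and let $P_\lambda=Q_\lambda/b_\lambda(t)$, where $b_\lambda(t)=\prod_{i\ge1}\prod_{j=1}^{k_i}(1-t^j)$. The products $p_\lambda=p_{\lambda_1}p_{\lambda_2}\cdots$ form a basis of $\Lambda$; let ${}^*$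 denote conjugation of operators relative to the bilinear form on $\Lambda$ with $$\langle p_\lambda,p_\mu\rangle_{q,t}=\delta_{\lambda\mu}\prod_{i\ge1}i^{k_i}k_i!\,\Bigl(\frac{1-q^i}{1-t^i}\Bigr)^{k_i},$$ where a symmetric function $f$ is identified with the operator of multiplication by $f$, and let $Q^*(z)=\sum_{n\ge0}Q_n^*z^n$. Write $(a;b)_k=\prod_{j=0}^{k-1}(1-ab^j)$. For $k\ge0$ let $$A^{(k)}=\sum_{\ell(\lambda)=k}q^{-\lambda_1-\lambda_2-\cdots}\,Q_\lambda P_\lambda^*,\qquad A(u)=\sum_{k\ge0}\frac{A^{(k)}}{(u;t^{-1})_k},$$ and let $S^{(k)}$ be the constant term of the formal series in $z_1,\dots,z_k$ $$Q(z_1)\cdots Q(z_k)\,Q^*(q^{-1}z_1^{-1})\cdots Q^*(q^{-1}z_k^{-1})\,F(z_1,\dots,z_k),$$ so that $A^{(0)}=S^{(0)}=1$. Let $(u^{-1};t)_\infty=\prod_{j\ge0}(1-u^{-1}t^j)$, as a formal power series in $u^{-1}$ over $\mathbb F$ whose coefficients are limits in the $t$-adic topology of $\mathbb F=\mathbb Q(q)(t)$.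 **Proposition.** The product $(u^{-1};t)_\infty$ converges, and the sums defining $A^{(k)}$ and $S^{(k)}$ have, for each $f\in\Lambda$, only finitely many summands that do not vanish on $f$. As formal power series in $u^{-1}$ whose coefficients are linear operators on $\Lambda$, $$(u^{-1};t)_\infty\,A(u)=\sum_{k\ge0}\frac{(ut)^{-k}\,S^{(k)}}{(t^{-1};t^{-1})_k}.$$ Moreover, for every $k\ge0$, $$S^{(k)}=\sum_{i=0}^k\frac{(t;t)_k}{(t;t)_{k-i}}\,A^{(i)}.$$ -/

import Mathlib

noncomputable section

namespace MacdonaldLax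

section Sym

/-- The algebra of symmetric functions in the variables `x_0, x_1, …` over `K`: the formal power
series of bounded degree which are invariant under permutations of the variables. -/
def SymFun (K : Type*) [Field K] : Subalgebra K (MvPowerSeries ℕ K) where
  carrier := {f | (∀ σ : Equiv.Perm ℕ, MvPowerSeries.renameEquiv K σ f = f) ∧
    ∃ d : ℕ, ∀ m : ℕ →₀ ℕ, d < m.degree → MvPowerSeries.coeff m f = 0}
  mul_mem' := by
    rintro f g ⟨hf, d, hd⟩ ⟨hg, e, he⟩
    refine ⟨fun σ => by rw [map_mul, hf σ, hg σ], d + e, fun m hm => ?_⟩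
    rw [MvPowerSeries.coeff_mul]
    refine Finset.sum_eq_zero fun p hp => ?_
    rw [Finset.HasAntidiagonal.mem_antidiagonal] at hp
    have h : p.1.degree + p.2.degree = m.degree := by rw [← hp, map_add]
    by_cases h1 : d < p.1.degree
    · rw [hd _ h1, zero_mul]
    · rw [he p.2 (by omega), mul_zero]
  add_mem' := by
    rintro f g ⟨hf, d, hd⟩ ⟨hg, e, he⟩
    refine ⟨fun σ => by rw [map_add, hf σ, hg σ], d + e, fun m hm => ?_⟩
    rw [map_add, hd m (by omega), he m (by omega), add_zero]
  algebraMap_mem' := by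
    classical
    intro r
    refine ⟨fun σ => AlgEquiv.commutes _ r, 0, fun m hm => ?_⟩
    have : m ≠ 0 := by rintro rfl; simp at hm
    rw [MvPowerSeries.algebraMap_apply, MvPowerSeries.coeff_C, if_neg this]

variable (K : Type*) [Field K]

lemma renameEquiv_eq_of_coeff {f : MvPowerSeries ℕ K}
    (h : ∀ (σ : Equiv.Perm ℕ) (m : ℕ →₀ ℕ),
      MvPowerSeries.coeff (m.embDomain σ.toEmbedding) f = MvPowerSeries.coeff m f)
    (σ : Equiv.Perm ℕ) : MvPowerSeries.renameEquiv K σ f = f := by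
  ext m
  obtain ⟨m', rfl⟩ : ∃ m' : ℕ →₀ ℕ, m = m'.embDomain σ.toEmbedding := by
    refine ⟨m.embDomain σ.symm.toEmbedding, ?_⟩
    ext i
    obtain ⟨j, rfl⟩ := σ.surjective i
    have h1 := Finsupp.embDomain_apply_self σ.toEmbedding (m.embDomain σ.symm.toEmbedding) j
    have h2 := Finsupp.embDomain_apply_self σ.symm.toEmbedding m (σ j)
    simp at h1 h2
    rw [h1, h2]
  rw [h σ m']
  exact MvPowerSeries.coeff_embDomain_rename σ.toEmbedding f m'

open Classical in
/-- The formal power series `x_0 ^ n + x_1 ^ n + ⋯`, for `n ≥ 1`. -/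
def powerSumSeries (n : ℕ+) : MvPowerSeries ℕ K :=
  fun m => if ∃ i, m = Finsupp.single i (n : ℕ) then 1 else 0

open Classical in
lemma coeff_powerSumSeries (n : ℕ+) (m : ℕ →₀ ℕ) :
    MvPowerSeries.coeff m (powerSumSeries K n) =
      if ∃ i, m = Finsupp.single i (n : ℕ) then 1 else 0 := rfl

open Classical in
/-- The sum of all square-free monomials of degree `n` in `x_0, x_1, …`. -/
def elemSymSeries (n : ℕ) : MvPowerSeries ℕ K :=
  fun m => if m.degree = n ∧ ∀ i, m i ≤ 1 then 1 else 0

open Classical in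
lemma coeff_elemSymSeries (n : ℕ) (m : ℕ →₀ ℕ) :
    MvPowerSeries.coeff m (elemSymSeries K n) =
      if m.degree = n ∧ ∀ i, m i ≤ 1 then 1 else 0 := rfl

open Classical in
/-- The power sum symmetric function `p_n`, for `n ≥ 1`. -/
def powerSum (n : ℕ+) : SymFun K :=
  ⟨powerSumSeries K n, by
    refine ⟨renameEquiv_eq_of_coeff K fun σ m => ?_, n, fun m hm => ?_⟩
    · rw [coeff_powerSumSeries, coeff_powerSumSeries]
      refine if_congr (Iff.intro ?_ ?_) rfl rfl
      · rintro ⟨i, hi⟩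
        obtain ⟨j, rfl⟩ := σ.surjective i
        refine ⟨j, Finsupp.embDomain_injective σ.toEmbedding ?_⟩
        rw [hi, Finsupp.embDomain_single]; rfl
      · rintro ⟨i, rfl⟩
        exact ⟨σ i, Finsupp.embDomain_single _ _ _⟩
    · rw [coeff_powerSumSeries, if_neg]
      rintro ⟨i, rfl⟩
      simp at hm⟩

open Classical in
/-- The elementary symmetric function `e_n`. -/
def elemSym (n : ℕ) : SymFun K :=
  ⟨elemSymSeries K n, by
    refine ⟨renameEquiv_eq_of_coeff K fun σ m => ?_, n, fun m hm => ?_⟩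
    · rw [coeff_elemSymSeries, coeff_elemSymSeries]
      refine if_congr (and_congr ?_ ⟨fun h i => ?_, fun h i => ?_⟩) rfl rfl
      · rw [Finsupp.degree_apply, Finsupp.degree_apply, Finsupp.support_embDomain,
          Finset.sum_map]
        simp only [Finsupp.embDomain_apply_self]
      · rw [← Finsupp.embDomain_apply_self σ.toEmbedding m i]
        exact h _
      · obtain ⟨j, rfl⟩ := σ.surjective i
        exact (Finsupp.embDomain_apply_self σ.toEmbedding m j).le.trans (h j)
    · rw [coeff_elemSymSeries, if_neg]
      rintro ⟨h, -⟩
      omega⟩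

lemma esymm_mem_adjoin_psum [CharZero K] (N k : ℕ) (hkN : k ≤ N) :
    MvPolynomial.esymm (Fin N) K k ∈ Algebra.adjoin K
      (Set.range fun i : Fin N => MvPolynomial.psum (Fin N) K (i + 1)) := by
  induction k using Nat.strong_induction_on with
  | _ k ih =>
  rcases Nat.eq_zero_or_pos k with rfl | hk
  · rw [MvPolynomial.esymm_zero]; exact one_mem _
  · have h := MvPolynomial.mul_esymm_eq_sum (Fin N) K k
    have h2 : MvPolynomial.esymm (Fin N) K k = (k : K)⁻¹ • ((k : MvPolynomial (Fin N) K) *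
        MvPolynomial.esymm (Fin N) K k) := by
      have : (k : K) ≠ 0 := by exact_mod_cast hk.ne'
      rw [Algebra.smul_def, ← mul_assoc, ← map_natCast (algebraMap K (MvPolynomial (Fin N) K)) k,
        ← map_mul, inv_mul_cancel₀ this, map_one, one_mul]
    rw [h2, h]
    refine Subalgebra.smul_mem _ (mul_mem (pow_mem (neg_mem (one_mem _)) _)
      (sum_mem fun a ha => ?_)) _
    rw [Finset.mem_filter] at ha
    have ha' := Finset.HasAntidiagonal.mem_antidiagonal.1 ha.1
    refine mul_mem (mul_mem (pow_mem (neg_mem (one_mem _)) _) (ih _ ha.2 (by omega))) ?_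
    refine Algebra.subset_adjoin ⟨⟨a.2 - 1, by omega⟩, ?_⟩
    have h3 : a.2 - 1 + 1 = a.2 := by omega
    simp only [h3]

lemma symmetric_mem_adjoin_psum [CharZero K] (N : ℕ) {g : MvPolynomial (Fin N) K}
    (hg : g.IsSymmetric) : g ∈ Algebra.adjoin K
      (Set.range fun i : Fin N => MvPolynomial.psum (Fin N) K (i + 1)) := by
  obtain ⟨G, hG⟩ := MvPolynomial.esymmAlgHom_surjective (R := K) (σ := Fin N) (n := N)
    (Fintype.card_fin N).le ⟨g, hg⟩
  have h := MvPolynomial.esymmAlgHom_apply (σ := Fin N) G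
  rw [hG] at h
  simp only at h
  rw [h]
  have : ∀ i : Fin N, MvPolynomial.esymm (Fin N) K (i + 1) ∈ Algebra.adjoin K
      (Set.range fun i : Fin N => MvPolynomial.psum (Fin N) K (i + 1)) :=
    fun i => esymm_mem_adjoin_psum K N (i + 1) i.2
  have h3 : (MvPolynomial.aeval (fun i : Fin N => MvPolynomial.esymm (Fin N) K (i + 1))).range ≤
      Algebra.adjoin K (Set.range fun i : Fin N => MvPolynomial.psum (Fin N) K (i + 1)) := by
    rw [← Algebra.adjoin_range_eq_range_aeval, Algebra.adjoin_le_iff]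
    rintro _ ⟨i, rfl⟩
    exact this i
  exact h3 ⟨G, rfl⟩

lemma injective_of_surjective_noetherian {R : Type*} [CommRing R] [IsNoetherianRing R]
    (f : R →+* R) (hf : Function.Surjective f) : Function.Injective f := by
  have hit : ∀ n : ℕ, Function.Surjective ((f ^ n : R →+* R) : R → R) := by
    intro n
    rw [RingHom.coe_pow]
    exact hf.iterate n
  obtain ⟨n, hn⟩ := monotone_stabilizes_iff_noetherian.2 (inferInstance : IsNoetherian R R)
    ⟨fun n => RingHom.ker (f ^ n), monotone_nat_of_le_succ fun n x hx => by
      rw [RingHom.mem_ker] at hx ⊢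
      rw [pow_succ', RingHom.mul_def, RingHom.comp_apply, hx, map_zero]⟩
  rw [injective_iff_map_eq_zero]
  intro x hx
  obtain ⟨y, rfl⟩ := hit n x
  have h1 : y ∈ RingHom.ker (f ^ (n + 1)) := by
    rw [RingHom.mem_ker, pow_succ', RingHom.mul_def, RingHom.comp_apply, hx]
  have h2 : RingHom.ker (f ^ n) = RingHom.ker (f ^ (n + 1)) := hn (n + 1) (Nat.le_succ n)
  rwa [← h2] at h1

lemma aeval_psum_injective [CharZero K] (N : ℕ) : Function.Injective (MvPolynomial.aeval (R := K)
    (fun i : Fin N => MvPolynomial.psum (Fin N) K (i + 1))) := by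
  let Φ : MvPolynomial (Fin N) K →ₐ[K] MvPolynomial.symmetricSubalgebra (Fin N) K :=
    MvPolynomial.aeval fun i : Fin N =>
      ⟨MvPolynomial.psum (Fin N) K (i + 1), MvPolynomial.psum_isSymmetric _ _ _⟩
  have hΦ : (MvPolynomial.symmetricSubalgebra (Fin N) K).val.comp Φ = MvPolynomial.aeval
      (fun i : Fin N => MvPolynomial.psum (Fin N) K (i + 1)) := by
    ext i : 1
    simp [Φ]
  have hsurj : Function.Surjective Φ := by
    rintro ⟨g, hg⟩
    have h := symmetric_mem_adjoin_psum K N hg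
    rw [Algebra.adjoin_range_eq_range_aeval] at h
    obtain ⟨G, hG⟩ := h
    refine ⟨G, Subtype.ext ?_⟩
    rw [← hΦ] at hG
    exact hG
  let e := (MvPolynomial.esymmAlgEquiv (R := K) (Fin N) (Fintype.card_fin N)).symm
  have h1 : Function.Injective
      ((e.toAlgHom.comp Φ : MvPolynomial (Fin N) K →ₐ[K] MvPolynomial (Fin N) K) :
        MvPolynomial (Fin N) K →+* MvPolynomial (Fin N) K) :=
    injective_of_surjective_noetherian _ (e.surjective.comp hsurj)
  rw [← hΦ]
  have h2 : Function.Injective Φ := fun a b hab => h1 (congrArg e hab)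
  exact Subtype.val_injective.comp h2

/-- Setting all but the first `N` variables to zero. -/
def restrictVars (N : ℕ) : MvPowerSeries ℕ K →ₐ[K] MvPowerSeries (Fin N) K :=
  MvPowerSeries.killCompl Fin.valEmbedding

lemma restrictVars_powerSum (N : ℕ) (n : ℕ+) :
    restrictVars K N (powerSumSeries K n) = (MvPolynomial.psum (Fin N) K n :) := by
  classical
  ext m
  rw [restrictVars, MvPowerSeries.coeff_killCompl, coeff_powerSumSeries,
    MvPolynomial.coeff_coe, MvPolynomial.psum, MvPolynomial.coeff_sum]
  simp only [MvPolynomial.coeff_X_pow]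
  by_cases h : ∃ i : Fin N, m = Finsupp.single i (n : ℕ)
  · obtain ⟨i, rfl⟩ := h
    rw [if_pos ⟨i, Finsupp.embDomain_single _ _ _⟩, Finset.sum_eq_single i]
    · simp
    · intro j _ hj
      rw [if_neg]
      intro h
      rw [Finsupp.single_left_inj n.pos.ne'] at h
      exact hj h
    · simp
  · rw [if_neg, Finset.sum_eq_zero]
    · intro i _
      rw [if_neg]
      exact fun hi => h ⟨i, hi.symm⟩
    · rintro ⟨i, hi⟩
      have hi' : (m.embDomain Fin.valEmbedding) i ≠ 0 := by
        rw [hi, Finsupp.single_eq_same]; exact n.pos.ne'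
      have : i ∈ Set.range (Fin.valEmbedding (n := N)) := by
        by_contra hc
        exact hi' (Finsupp.embDomain_of_notMem_range _ _ _ hc)
      obtain ⟨j, rfl⟩ := this
      refine h ⟨j, Finsupp.embDomain_injective Fin.valEmbedding ?_⟩
      rw [hi, Finsupp.embDomain_single]

lemma restrictVars_aeval (N : ℕ) (G : MvPolynomial ℕ+ K) :
    restrictVars K N (MvPolynomial.aeval (powerSumSeries K) G) =
      (MvPolynomial.aeval (fun n : ℕ+ => MvPolynomial.psum (Fin N) K n) G :) := by
  have : (restrictVars K N).comp (MvPolynomial.aeval (powerSumSeries K)) =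
      (MvPolynomial.coeToMvPowerSeries.algHom K).comp
        (MvPolynomial.aeval (fun n : ℕ+ => MvPolynomial.psum (Fin N) K n)) := by
    ext n : 1
    simp [restrictVars_powerSum]
  simpa using DFunLike.congr_fun this G

lemma exists_homComp (e : ℕ) (G : MvPolynomial ℕ+ K) : ∃ G' : MvPolynomial ℕ+ K,
    MvPolynomial.aeval (powerSumSeries K) G' =
      MvPowerSeries.homogeneousComponent e (MvPolynomial.aeval (powerSumSeries K) G) := by
  induction G using MvPolynomial.induction_on' with
  | monomial s c =>
    have h1 : ∃ w, MvPowerSeries.IsHomogeneous (1 : MvPowerSeries ℕ K) w := by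
      classical
      refine ⟨0, MvPowerSeries.isHomogeneous_iff_eq_homogeneousComponent.2 ?_⟩
      ext m
      rw [MvPowerSeries.coeff_homogeneousComponent, MvPowerSeries.coeff_one]
      by_cases hm : m = 0 <;> simp [hm]
    have hmul : ∀ f g : MvPowerSeries ℕ K, (∃ w, f.IsHomogeneous w) → (∃ w, g.IsHomogeneous w) →
        ∃ w, (f * g).IsHomogeneous w := fun f g ⟨v, hv⟩ ⟨w, hw⟩ => ⟨v + w, hv.mul hw⟩
    have hp : ∀ (n : ℕ+) (k : ℕ), ∃ w, (powerSumSeries K n ^ k).IsHomogeneous w := by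
      intro n k
      induction k with
      | zero => rw [pow_zero]; exact h1
      | succ k ih =>
        rw [pow_succ]
        refine hmul _ _ ih ⟨n, MvPowerSeries.isHomogeneous_iff_eq_homogeneousComponent.2 ?_⟩
        ext m
        rw [MvPowerSeries.coeff_homogeneousComponent, coeff_powerSumSeries]
        split_ifs with h2 h3 h3
        · rfl
        · obtain ⟨i, rfl⟩ := h2
          simp at h3
        · rfl
        · rfl
    obtain ⟨w, hw⟩ : ∃ w, (s.prod fun n k => powerSumSeries K n ^ k).IsHomogeneous w :=
      Finset.prod_induction _ (fun f : MvPowerSeries ℕ K => ∃ w, f.IsHomogeneous w) hmul h1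
        fun n _ => hp n _
    refine ⟨if w = e then MvPolynomial.monomial s c else 0, ?_⟩
    rw [MvPolynomial.aeval_monomial, ← Algebra.smul_def, map_smul]
    split_ifs with h
    · rw [MvPolynomial.aeval_monomial, ← Algebra.smul_def, ← h,
        ← MvPowerSeries.isHomogeneous_iff_eq_homogeneousComponent.1 hw]
    · rw [map_zero]
      suffices h' : MvPowerSeries.homogeneousComponent e
          (s.prod fun n k => powerSumSeries K n ^ k) = 0 by rw [h', smul_zero]
      ext m
      rw [MvPowerSeries.coeff_homogeneousComponent, map_zero]
      split_ifs with hm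
      · exact hw.coeff_eq_zero (by rw [hm]; exact Ne.symm h)
      · rfl
  | add p q hp hq =>
    obtain ⟨p', hp⟩ := hp
    obtain ⟨q', hq⟩ := hq
    exact ⟨p' + q', by rw [map_add, map_add, map_add, hp, hq]⟩

lemma aeval_powerSumSeries_injective [CharZero K] :
    Function.Injective (MvPolynomial.aeval (R := K) (powerSumSeries K)) := by
  rw [injective_iff_map_eq_zero]
  intro G hG
  obtain ⟨s, G, rfl⟩ := MvPolynomial.exists_finset_rename G
  -- embed the finitely many indices into an initial segment
  obtain ⟨N, hN⟩ : ∃ N : ℕ, ∀ n ∈ s, (n : ℕ) ≤ N :=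
    ⟨s.sup (fun n => (n : ℕ)), fun n hn => Finset.le_sup (f := fun n : ℕ+ => (n : ℕ)) hn⟩
  let j : s → Fin N := fun n => ⟨n.1 - 1, by
    have := hN n.1 n.2
    have := n.1.pos
    omega⟩
  have hj : Function.Injective j := by
    intro a b hab
    have h1 : (a.1 : ℕ) - 1 = (b.1 : ℕ) - 1 := congrArg Fin.val hab
    have := a.1.pos
    have := b.1.pos
    exact Subtype.ext (PNat.eq (by omega))
  have h := restrictVars_aeval K N (MvPolynomial.rename Subtype.val G)
  rw [hG, map_zero] at h
  have h0 : MvPolynomial.aeval (fun i : Fin N => MvPolynomial.psum (Fin N) K (i + 1))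
      (MvPolynomial.rename j G) = 0 := by
    rw [MvPolynomial.aeval_rename] at h ⊢
    have hc : (fun i : Fin N => MvPolynomial.psum (Fin N) K (i + 1)) ∘ j =
        (fun n : ℕ+ => MvPolynomial.psum (Fin N) K n) ∘ Subtype.val := by
      funext n
      have := n.1.pos
      simp only [Function.comp, j]
      congr 1
      omega
    rw [hc]
    exact MvPolynomial.coe_injective _ _ (by rw [← h, MvPolynomial.coe_zero])
  have hinj := aeval_psum_injective K N
  have h1 : MvPolynomial.rename j G = 0 := hinj (by rw [h0, map_zero])
  have h2 : G = 0 := MvPolynomial.rename_injective j hj (by rw [h1, map_zero])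
  rw [h2, map_zero]

lemma SymFun.coeff_embDomain {d : ℕ} (f : SymFun K) (m : Fin d →₀ ℕ) (e e' : Fin d ↪ ℕ) :
    MvPowerSeries.coeff (m.embDomain e) (f : MvPowerSeries ℕ K) =
      MvPowerSeries.coeff (m.embDomain e') (f : MvPowerSeries ℕ K) := by
  obtain ⟨σ, hσ⟩ := Equiv.Perm.exists_extending_pair e e' e.injective e'.injective
  have h1 : m.embDomain e' = (m.embDomain e).embDomain σ.toEmbedding := by
    simp only [Finsupp.embDomain_eq_mapDomain, ← Finsupp.mapDomain_comp]
    congr 1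
    funext i
    exact (hσ i).symm
  have h2 := MvPowerSeries.coeff_embDomain_rename σ.toEmbedding (f : MvPowerSeries ℕ K)
    (m.embDomain e)
  have h3 : MvPowerSeries.rename σ.toEmbedding (f : MvPowerSeries ℕ K) = f := f.2.1 σ
  rw [h3] at h2
  rw [h1, h2]

lemma exists_aeval_powerSumSeries [CharZero K] (f : SymFun K) : ∃ G : MvPolynomial ℕ+ K,
    MvPolynomial.aeval (powerSumSeries K) G = (f : MvPowerSeries ℕ K) := by
  obtain ⟨f, hf, d, hd⟩ := f
  -- the restriction of `f` to the first `d` variables is a symmetric polynomial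
  obtain ⟨g, hg, hgf⟩ : ∃ g : MvPolynomial (Fin d) K, g.IsSymmetric ∧
      restrictVars K d f = (g : MvPowerSeries (Fin d) K) := by
    classical
    let S := (Finsupp.finite_of_degree_le (σ := Fin d) d).toFinset
    let g : MvPolynomial (Fin d) K :=
      ∑ m ∈ S, MvPolynomial.monomial m (MvPowerSeries.coeff (m.embDomain Fin.valEmbedding) f)
    have hdeg : ∀ m : Fin d →₀ ℕ, (m.embDomain Fin.valEmbedding).degree = m.degree := by
      intro m
      rw [Finsupp.degree_apply, Finsupp.degree_apply, Finsupp.support_embDomain, Finset.sum_map]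
      simp only [Finsupp.embDomain_apply_self]
    have hcoeff : ∀ m, MvPolynomial.coeff m g =
        MvPowerSeries.coeff (m.embDomain Fin.valEmbedding) f := by
      intro m
      simp only [g, MvPolynomial.coeff_sum, MvPolynomial.coeff_monomial, Finset.sum_ite_eq']
      split_ifs with hm
      · rfl
      · rw [hd]
        simpa [S, hdeg] using hm
    refine ⟨g, fun τ => ?_, ?_⟩
    · ext m
      obtain ⟨m, rfl⟩ : ∃ m', m = Finsupp.mapDomain τ m' :=
        ⟨m.mapDomain τ.symm, by rw [← Finsupp.mapDomain_comp]; simp⟩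
      rw [MvPolynomial.coeff_rename_mapDomain _ τ.injective, hcoeff, hcoeff]
      have := SymFun.coeff_embDomain K ⟨f, hf, d, hd⟩ m Fin.valEmbedding
        (τ.toEmbedding.trans Fin.valEmbedding)
      rw [this]
      simp only [Finsupp.embDomain_eq_mapDomain, ← Finsupp.mapDomain_comp]
      rfl
    · ext m
      rw [restrictVars, MvPowerSeries.coeff_killCompl, MvPolynomial.coeff_coe, hcoeff]
  have h := symmetric_mem_adjoin_psum K d hg
  rw [Algebra.adjoin_range_eq_range_aeval] at h
  obtain ⟨G, hG⟩ := h
  let P : MvPolynomial ℕ+ K := MvPolynomial.rename (fun i : Fin d => Nat.succPNat i) G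
  have hP : restrictVars K d (MvPolynomial.aeval (powerSumSeries K) P) = restrictVars K d f := by
    rw [restrictVars_aeval, hgf, ← hG, MvPolynomial.aeval_rename]
    rfl
  choose! P' hP' using fun e => exists_homComp K e P
  refine ⟨∑ e ∈ Finset.range (d + 1), P' e, ?_⟩
  ext m
  rw [map_sum, map_sum]
  simp only [hP', MvPowerSeries.coeff_homogeneousComponent]
  rw [Finset.sum_ite_eq]
  split_ifs with hm
  · have hcard : m.support.card ≤ d := by
      refine le_trans ?_ (Finset.mem_range_succ_iff.1 hm)
      rw [Finsupp.degree_apply, Finset.card_eq_sum_ones]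
      exact Finset.sum_le_sum fun i hi =>
        Nat.one_le_iff_ne_zero.2 (Finsupp.mem_support_iff.1 hi)
    obtain ⟨s, hs, hsd⟩ := Infinite.exists_superset_card_eq m.support d hcard
    let e := (s.orderEmbOfFin hsd).toEmbedding
    have he : (m.comapDomain e e.injective.injOn).embDomain e = m := by
      refine Finsupp.embDomain_comapDomain ?_
      rw [show Set.range e = s from Finset.range_orderEmbOfFin s hsd]
      exact_mod_cast hs
    let F : SymFun K := ⟨f, hf, d, hd⟩
    have h1 := SymFun.coeff_embDomain K F (m.comapDomain e e.injective.injOn) e Fin.valEmbedding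
    have h2 := SymFun.coeff_embDomain K (MvPolynomial.aeval (powerSum K) P)
      (m.comapDomain e e.injective.injOn) e Fin.valEmbedding
    have h3 : ((MvPolynomial.aeval (powerSum K) P : SymFun K) : MvPowerSeries ℕ K) =
        MvPolynomial.aeval (powerSumSeries K) P :=
      (Subalgebra.mvPolynomial_aeval_coe _ _ _).symm
    rw [he, h3] at h2
    rw [he] at h1
    rw [h1, h2, ← MvPowerSeries.coeff_killCompl, ← MvPowerSeries.coeff_killCompl]
    exact congrArg _ hP
  · rw [hd]
    simpa using hm

/-- The power sums are free generators of the algebra of symmetric functions. -/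
def powerSumEquiv [CharZero K] : MvPolynomial ℕ+ K ≃ₐ[K] SymFun K :=
  AlgEquiv.ofBijective (MvPolynomial.aeval (powerSum K)) (by
    have h (G) : ((MvPolynomial.aeval (powerSum K) G : SymFun K) : MvPowerSeries ℕ K) =
        MvPolynomial.aeval (powerSumSeries K) G :=
      (Subalgebra.mvPolynomial_aeval_coe _ _ _).symm
    refine ⟨fun a b hab => aeval_powerSumSeries_injective K ?_, fun f => ?_⟩
    · rw [← h, ← h, hab]
    · obtain ⟨G, hG⟩ := exists_aeval_powerSumSeries K f
      exact ⟨G, Subtype.ext (by rw [h, hG])⟩)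

/-- The basis of power sum products `p_λ`. The index `a : ℕ+ →₀ ℕ` is the partition in which each
`n ≥ 1` has multiplicity `a n`. -/
def powerSumBasis [CharZero K] : Module.Basis (ℕ+ →₀ ℕ) K (SymFun K) :=
  (MvPolynomial.basisMonomials ℕ+ K).map (powerSumEquiv K).toLinearEquiv

lemma powerSumBasis_apply [CharZero K] (a : ℕ+ →₀ ℕ) :
    powerSumBasis K a = a.prod fun n k => powerSum K n ^ k := by
  have h (G) : powerSumEquiv K G = MvPolynomial.aeval (powerSum K) G := rfl
  simp [powerSumBasis, h, MvPolynomial.aeval_monomial]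

end Sym

section Series

/-- The finite `q`-Pochhammer symbol `(a; b)_k = ∏_{j=0}^{k-1} (1 - a b^j)`. -/
def qPoch {R : Type*} [CommRing R] (a b : R) (k : ℕ) : R :=
  ∏ j ∈ Finset.range k, (1 - a * b ^ j)

open scoped PowerSeries.WithPiTopology in
/-- The infinite product `(v; t)_∞ = ∏_{j ≥ 0} (1 - v t^j)` as a formal power series in `v`, the
coefficients converging in the topology of `K`. -/
def qPochInf {K : Type*} [Field K] [TopologicalSpace K] (t : K) : PowerSeries K :=
  ∏' j : ℕ, (1 - PowerSeries.C (t ^ j) * PowerSeries.X)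

variable (K : Type*) [Field K]

/-- `E(z) = ∑ e_n z^n`. -/
def seriesE : PowerSeries (SymFun K) := PowerSeries.mk (elemSym K)

/-- `H(z) = ∑ h_n z^n`, determined by `E(-z) H(z) = 1`. -/
def seriesH : PowerSeries (SymFun K) :=
  PowerSeries.invOfUnit (PowerSeries.rescale (-1) (seriesE K)) 1

lemma seriesE_mul_seriesH : PowerSeries.rescale (-1) (seriesE K) * seriesH K = 1 := by
  classical
  refine PowerSeries.mul_invOfUnit _ _ ?_
  rw [← PowerSeries.coeff_zero_eq_constantCoeff_apply, PowerSeries.coeff_rescale, seriesE,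
    PowerSeries.coeff_mk, pow_zero, one_mul]
  refine Subtype.ext (MvPowerSeries.ext fun m => ?_)
  have h1 : MvPowerSeries.coeff m ((elemSym K 0 : SymFun K) : MvPowerSeries ℕ K) =
    if m.degree = 0 ∧ ∀ i, m i ≤ 1 then 1 else 0 := coeff_elemSymSeries K 0 m
  have h2 : MvPowerSeries.coeff m ((((1 : (SymFun K)ˣ) : SymFun K)) : MvPowerSeries ℕ K) =
    if m = 0 then 1 else 0 := MvPowerSeries.coeff_one m
  rw [h1, h2]
  refine if_congr ?_ rfl rfl
  rw [Finsupp.degree_eq_zero_iff]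
  constructor
  · exact And.left
  · rintro rfl
    simp

variable {K} (t : K)

/-- `Q(z) = E(-t z) H(z) = ∑ Q_n z^n`. -/
def seriesQ : PowerSeries (SymFun K) :=
  PowerSeries.rescale (-algebraMap K (SymFun K) t) (seriesE K) * seriesH K

/-- The symmetric function `Q_n`. -/
def oneRowQ (n : ℕ) : SymFun K := PowerSeries.coeff n (seriesQ t)

/-- The expansion of `(z - w) / (z - t w)` as a power series in the ratio `w / z`. -/
def ratioSeries : PowerSeries K :=
  (1 - PowerSeries.X) * (1 - PowerSeries.C t * PowerSeries.X)⁻¹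

/-- The pairs `i < j`. -/
abbrev PairLT (k : ℕ) : Type := {p : Fin k × Fin k // p.1 < p.2}

/-- The exponent vector of the monomial `∏_{i < j} (z_j / z_i) ^ c(i,j)`. -/
def ratioExponent {k : ℕ} (c : PairLT k → ℕ) : Fin k → ℤ :=
  ∑ p : PairLT k, (c p : ℤ) • (Pi.single p.1.2 1 - Pi.single p.1.1 1 : Fin k → ℤ)

/-- The coefficient at `z^a` of the formal series
`F(z_1, …, z_k) = ∏_{i < j} (z_i - z_j) / (z_i - t z_j)`, every factor being expanded as a power
series in `z_j / z_i`. -/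
def coeffF {k : ℕ} (a : Fin k → ℤ) : K :=
  ∑ᶠ c ∈ {c : PairLT k → ℕ | ratioExponent c = a},
    ∏ p, PowerSeries.coeff (c p) (ratioSeries t)

lemma ratioExponent_finite {k : ℕ} (a : Fin k → ℤ) :
    {c : PairLT k → ℕ | ratioExponent c = a}.Finite := by
  let W : ℕ := (∑ l : Fin k, (l : ℤ) * a l).toNat
  refine (Set.Finite.pi' (fun _ : PairLT k => Set.finite_Iic W)).subset ?_
  intro c hc p
  have hc' : ratioExponent c = a := hc
  have h : ∑ l : Fin k, (l : ℤ) * a l =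
      ∑ p : PairLT k, (c p : ℤ) * ((p.1.2 : ℤ) - (p.1.1 : ℤ)) := by
    rw [← hc']
    simp only [ratioExponent, Finset.sum_apply, Pi.smul_apply, Pi.sub_apply, smul_eq_mul,
      Finset.mul_sum]
    rw [Finset.sum_comm]
    refine Finset.sum_congr rfl fun p _ => ?_
    simp only [mul_left_comm _ (c p : ℤ), ← Finset.mul_sum, mul_sub, Finset.sum_sub_distrib]
    simp [Pi.single_apply]
  have h1 : ∀ p : PairLT k, (c p : ℤ) ≤ (c p : ℤ) * ((p.1.2 : ℤ) - (p.1.1 : ℤ)) := by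
    intro p
    have hp : (p.1.1 : ℕ) < (p.1.2 : ℕ) := p.2
    nlinarith [(Int.natCast_nonneg (c p))]
  have h2 : (c p : ℤ) ≤ ∑ l : Fin k, (l : ℤ) * a l := by
    rw [h]
    exact (h1 p).trans (Finset.single_le_sum
      (f := fun p : PairLT k => (c p : ℤ) * ((p.1.2 : ℤ) - (p.1.1 : ℤ)))
      (fun r _ => (Int.natCast_nonneg (c r)).trans (h1 r)) (Finset.mem_univ p))
  show c p ≤ W
  omega

lemma sum_eq_zero_of_coeffF_ne_zero {k : ℕ} {a : Fin k → ℤ} (h : coeffF t a ≠ 0) :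
    ∑ l, a l = 0 := by
  obtain ⟨c, hc⟩ := exists_ne_zero_of_finsum_mem_ne_zero h
  obtain ⟨hc : ratioExponent c = a, -⟩ := hc
  rw [← hc]
  simp only [ratioExponent, Finset.sum_apply, Pi.smul_apply, Pi.sub_apply, smul_eq_mul]
  rw [Finset.sum_comm]
  refine Finset.sum_eq_zero fun p _ => ?_
  rw [← Finset.mul_sum, Finset.sum_sub_distrib]
  simp

/-- The Hall-Littlewood function `Q_λ` of a partition `λ = (λ_1, …, λ_k)`: the coefficient at `z^λ`
of the formal series `Q(z_1) ⋯ Q(z_k) F(z_1, …, z_k)`. -/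
def hallLittlewoodQ {k : ℕ} (l : Fin k → ℕ) : SymFun K :=
  ∑ᶠ m : Fin k → ℕ, coeffF t (fun i => (l i : ℤ) - m i) • ∏ i, oneRowQ t (m i)

lemma hallLittlewoodQ_finite {k : ℕ} (l : Fin k → ℕ) :
    {m : Fin k → ℕ | coeffF t (fun i => (l i : ℤ) - m i) ≠ 0}.Finite := by
  refine (Set.Finite.pi' (fun _ : Fin k => Set.finite_Iic (∑ i, l i))).subset ?_
  intro m hm i
  have h := sum_eq_zero_of_coeffF_ne_zero t hm
  rw [Finset.sum_sub_distrib, sub_eq_zero] at h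
  have h' : ∑ i, l i = ∑ i, m i := by exact_mod_cast h
  show m i ≤ ∑ i, l i
  rw [h']
  exact Finset.single_le_sum (f := m) (fun _ _ => Nat.zero_le _) (Finset.mem_univ i)

/-- `b_λ(t) = ∏_{i ≥ 1} ∏_{j = 1}^{k_i} (1 - t^j)`, where `k_i` is the multiplicity of `i` in `λ`. -/
def hallLittlewoodB {k : ℕ} (l : Fin k → ℕ) : K :=
  ∏ i ∈ Finset.univ.image l, qPoch t t (Finset.univ.filter fun r => l r = i).card

/-- `P_λ = Q_λ / b_λ(t)`. -/
def hallLittlewoodP {k : ℕ} (l : Fin k → ℕ) : SymFun K :=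
  (hallLittlewoodB t l)⁻¹ • hallLittlewoodQ t l

/-- Partitions with exactly `k` non-zero parts. -/
abbrev PartitionOfLength (k : ℕ) : Type := {l : Fin k → ℕ // Antitone l ∧ ∀ i, 0 < l i}

end Series

section Form

variable {K : Type*} [Field K] [CharZero K] (q t : K)

/-- `⟨p_λ, p_λ⟩_{q,t} = ∏_i i^{k_i} k_i! ((1 - q^i) / (1 - t^i))^{k_i}`, where `k_i = a i` is the
multiplicity of `i` in `λ`. -/
def powerSumNorm (a : ℕ+ →₀ ℕ) : K :=
  a.prod fun i k => (i : K) ^ k * (k.factorial : K) *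
    ((1 - q ^ (i : ℕ)) / (1 - t ^ (i : ℕ))) ^ k

open Classical in
/-- The bilinear form `⟨ , ⟩_{q,t}`: the products `p_λ` are pairwise orthogonal. -/
def macdonaldForm : SymFun K →ₗ[K] SymFun K →ₗ[K] K :=
  (powerSumBasis K).constr K fun a => (powerSumBasis K).constr K fun b =>
    if a = b then powerSumNorm q t a else 0

/-- `T'` is conjugate to `T` relative to `⟨ , ⟩_{q,t}`. -/
def IsConjugate (T T' : Module.End K (SymFun K)) : Prop :=
  ∀ f g, macdonaldForm q t (T' f) g = macdonaldForm q t f (T g)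

open Classical in
/-- The operator conjugate to `T` relative to `⟨ , ⟩_{q,t}` (zero if there is none). -/
def conjugate (T : Module.End K (SymFun K)) : Module.End K (SymFun K) :=
  if h : ∃ T', IsConjugate q t T T' then h.choose else 0

/-- The operator of multiplication by `f`. -/
def mulOp (f : SymFun K) : Module.End K (SymFun K) := LinearMap.mulLeft K f

lemma exists_isConjugate_mulOp (f : SymFun K) : ∃ T', IsConjugate q t (mulOp f) T' := by
  classical
  obtain ⟨G, rfl⟩ := (powerSumEquiv K).surjective f
  have hB (a b : ℕ+ →₀ ℕ) : macdonaldForm q t (powerSumBasis K a) (powerSumBasis K b) =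
      if a = b then powerSumNorm q t a else 0 := by
    simp [macdonaldForm]
  induction G using MvPolynomial.induction_on with
  | C r =>
    refine ⟨r • LinearMap.id, fun f g => ?_⟩
    have : powerSumEquiv K (MvPolynomial.C r) = algebraMap K _ r := (powerSumEquiv K).commutes r
    rw [this]
    simp [mulOp, ← Algebra.smul_def]
  | add G G' h h' =>
    obtain ⟨T, hT⟩ := h
    obtain ⟨T', hT'⟩ := h'
    refine ⟨T + T', fun f g => ?_⟩
    have h1 := hT f g
    have h2 := hT' f g
    simp only [mulOp, LinearMap.mulLeft_apply] at h1 h2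
    simp [mulOp, add_mul, h1, h2]
  | mul_X G n h =>
    obtain ⟨T, hT⟩ := h
    obtain ⟨D, hD⟩ : ∃ D, IsConjugate q t (mulOp (powerSum K n)) D := by
      refine ⟨(powerSumBasis K).constr K fun a => if a n = 0 then 0 else
        ((n : K) * (a n : K) * ((1 - q ^ (n : ℕ)) / (1 - t ^ (n : ℕ)))) •
          powerSumBasis K (a - Finsupp.single n 1), fun f g => ?_⟩
      have hmul (b : ℕ+ →₀ ℕ) :
          powerSum K n * powerSumBasis K b = powerSumBasis K (b + Finsupp.single n 1) := by
        have h1 := Finsupp.prod_add_index' (f := b) (g := Finsupp.single n 1)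
          (h := fun (m : ℕ+) (k : ℕ) => powerSum K m ^ k)
          (fun _ => pow_zero _) (fun _ _ _ => pow_add _ _ _)
        have h2 : ((Finsupp.single n 1).prod fun (m : ℕ+) (k : ℕ) => powerSum K m ^ k) =
            powerSum K n := by simp
        rw [powerSumBasis_apply, powerSumBasis_apply, h1, h2, mul_comm]
      have hN (b : ℕ+ →₀ ℕ) : powerSumNorm q t (b + Finsupp.single n 1) =
          (n : K) * ((b n + 1 : ℕ) : K) * ((1 - q ^ (n : ℕ)) / (1 - t ^ (n : ℕ))) *
            powerSumNorm q t b := by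
        have hb : b = b.erase n + Finsupp.single n (b n) := (Finsupp.erase_add_single n b).symm
        have hsplit (k : ℕ) : powerSumNorm q t (b.erase n + Finsupp.single n k) =
            powerSumNorm q t (b.erase n) * ((n : K) ^ k * (k.factorial : K) *
              ((1 - q ^ (n : ℕ)) / (1 - t ^ (n : ℕ))) ^ k) := by
          rw [powerSumNorm, Finsupp.prod_add_index_of_disjoint]
          · rw [Finsupp.prod_single_index (by simp), powerSumNorm]
          · refine Finset.disjoint_left.2 fun i hi hi' => ?_
            rw [Finsupp.support_erase, Finset.mem_erase] at hi
            exact hi.1 (by simpa using Finsupp.support_single_subset hi')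
        have hb' : b + Finsupp.single n 1 = b.erase n + Finsupp.single n (b n + 1) := by
          rw [Finsupp.single_add, ← add_assoc, ← hb]
        rw [hb', hsplit]
        conv_rhs => rw [hb, hsplit]
        simp only [Finsupp.add_apply, Finsupp.erase_same, Finsupp.single_eq_same, zero_add]
        rw [Nat.factorial_succ]
        push_cast
        ring
      -- by bilinearity it suffices to treat basis vectors
      suffices h : (macdonaldForm q t).comp ((powerSumBasis K).constr K fun a =>
          if a n = 0 then 0 else
            ((n : K) * (a n : K) * ((1 - q ^ (n : ℕ)) / (1 - t ^ (n : ℕ)))) •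
              powerSumBasis K (a - Finsupp.single n 1)) =
          (macdonaldForm q t).compl₂ (mulOp (powerSum K n)) from
        LinearMap.congr_fun (LinearMap.congr_fun h f) g
      refine (powerSumBasis K).ext fun a => (powerSumBasis K).ext fun b => ?_
      rw [LinearMap.comp_apply, LinearMap.compl₂_apply, Module.Basis.constr_basis, mulOp,
        LinearMap.mulLeft_apply, hmul, hB]
      by_cases ha : a n = 0
      · rw [if_pos ha, map_zero, LinearMap.zero_apply, if_neg]
        rintro rfl
        simp at ha
      · rw [if_neg ha, map_smul, LinearMap.smul_apply, hB]
        have hle : Finsupp.single n 1 ≤ a := by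
          rw [Finsupp.single_le_iff]
          omega
        by_cases hab : a = b + Finsupp.single n 1
        · subst hab
          rw [add_tsub_cancel_right, if_pos rfl, if_pos rfl, hN, smul_eq_mul]
          simp
        · rw [if_neg hab, if_neg, smul_zero]
          rintro rfl
          exact hab (tsub_add_cancel_of_le hle).symm
    refine ⟨D * T, fun f g => ?_⟩
    have h1 := hD (T f) g
    have h2 := hT f (powerSum K n * g)
    simp only [mulOp, LinearMap.mulLeft_apply] at h1 h2 ⊢
    have hX : powerSumEquiv K (MvPolynomial.X n) = powerSum K n :=
      MvPolynomial.aeval_X _ _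
    rw [Module.End.mul_apply, h1, h2, map_mul (powerSumEquiv K), hX, mul_assoc]

/-- The defining property of the operator conjugate to a multiplication operator. -/
lemma isConjugate_conjugate_mulOp (f : SymFun K) :
    IsConjugate q t (mulOp f) (conjugate q t (mulOp f)) := by
  rw [conjugate, dif_pos (exists_isConjugate_mulOp q t f)]
  exact (exists_isConjugate_mulOp q t f).choose_spec

end Form

section Operators

variable {K : Type*} [Field K]

/-- A family of operators only finitely many of which are non-zero at any given vector. -/
def PointwiseFinite {ι : Type*} (T : ι → Module.End K (SymFun K)) : Prop :=
  ∀ f, {i | T i f ≠ 0}.Finite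

open Classical in
/-- The sum of a pointwise finite family of operators (zero if the family is not such). -/
def opSum {ι : Type*} (T : ι → Module.End K (SymFun K)) : Module.End K (SymFun K) :=
  if h : PointwiseFinite T then
    { toFun := fun f => ∑ᶠ i, T i f
      map_add' := fun f g => by
        simp only [map_add]
        exact finsum_add_distrib (h f) (h g)
      map_smul' := fun c f => by
        simp only [map_smul, RingHom.id_apply]
        exact (smul_finsum' c (h f)).symm }
  else 0

/-- `(u; t^{-1})_k` as a Laurent series in the variable `u^{-1}`. -/
def laurentPoch (t : K) (k : ℕ) : LaurentSeries K :=
  qPoch (HahnSeries.single (-1) 1) (HahnSeries.C t⁻¹) k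

lemma coeff_inv_laurentPoch {t : K} (ht : t ≠ 0) {n k : ℕ} (h : n < k) :
    ((laurentPoch t k)⁻¹).coeff (n : ℤ) = 0 := by
  let ι := HahnSeries.ofPowerSeries ℤ K
  let G : PowerSeries K := ∏ j ∈ Finset.range k, (PowerSeries.X - PowerSeries.C (t⁻¹ ^ j))⁻¹
  have h0 : laurentPoch t k * ι (PowerSeries.X ^ k * G) = 1 := by
    have h1 : PowerSeries.X ^ k = ∏ j ∈ Finset.range k, (PowerSeries.X : PowerSeries K) := by
      simp
    rw [h1, ← Finset.prod_mul_distrib, map_prod, laurentPoch, qPoch, ← Finset.prod_mul_distrib]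
    refine Finset.prod_eq_one fun j _ => ?_
    have h2 : HahnSeries.single (-1) 1 * ι PowerSeries.X = (1 : LaurentSeries K) := by
      rw [HahnSeries.ofPowerSeries_X, HahnSeries.single_mul_single]
      simp
    have h3 : (HahnSeries.C t⁻¹ : LaurentSeries K) ^ j = ι (PowerSeries.C (t⁻¹ ^ j)) := by
      rw [HahnSeries.ofPowerSeries_C, map_pow]
    rw [map_mul, ← mul_assoc, sub_mul, one_mul, h3, mul_right_comm, h2, one_mul, ← map_sub,
      ← map_mul, PowerSeries.mul_inv_cancel, map_one]
    simp [ht]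
  rw [inv_eq_of_mul_eq_one_right h0, HahnSeries.ofPowerSeries_apply_coeff,
    PowerSeries.coeff_X_pow_mul', if_neg (by omega)]

variable [CharZero K] (q t : K)

/-- The summand `q^{-|λ|} Q_λ P_λ^*` of `A^{(k)}`. -/
def termA {k : ℕ} (l : PartitionOfLength k) : Module.End K (SymFun K) :=
  (q⁻¹) ^ (∑ i, l.1 i) •
    (mulOp (hallLittlewoodQ t l.1) * conjugate q t (mulOp (hallLittlewoodP t l.1)))

/-- `A^{(k)} = ∑_{ℓ(λ) = k} q^{-|λ|} Q_λ P_λ^*`. -/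
def opA (k : ℕ) : Module.End K (SymFun K) :=
  opSum fun l : PartitionOfLength k => termA q t l

/-- The contribution to the constant term of
`Q(z_1) ⋯ Q(z_k) Q^*(q^{-1} z_1^{-1}) ⋯ Q^*(q^{-1} z_k^{-1}) F(z_1, …, z_k)` of the coefficient
`Q_{m_1} ⋯ Q_{m_k}` at `z^m` of the first `k` factors and of the coefficient
`q^{-|n|} Q_{n_1}^* ⋯ Q_{n_k}^*` at `z^{-n}` of the next `k` factors. It involves the coefficient
of `F` at `z^{n - m}`. -/
def termS {k : ℕ} (m n : Fin k → ℕ) : Module.End K (SymFun K) :=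
  (coeffF t (fun i => (n i : ℤ) - m i) * (q⁻¹) ^ (∑ i, n i)) •
    ((List.ofFn fun i => mulOp (oneRowQ t (m i))).prod *
      (List.ofFn fun i => conjugate q t (mulOp (oneRowQ t (n i)))).prod)

/-- `S^{(k)}`, the constant term of
`Q(z_1) ⋯ Q(z_k) Q^*(q^{-1} z_1^{-1}) ⋯ Q^*(q^{-1} z_k^{-1}) F(z_1, …, z_k)`. -/
def opS (k : ℕ) : Module.End K (SymFun K) :=
  opSum fun mn : (Fin k → ℕ) × (Fin k → ℕ) => termS q t mn.1 mn.2

/-- `A(u) = ∑_{k ≥ 0} A^{(k)} / (u; t^{-1})_k` as a formal power series in the variable `u^{-1}`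
with operator coefficients. As `1 / (u; t^{-1})_k` is divisible by `u^{-k}`, only the summands with
`k ≤ n` contribute to the coefficient at `u^{-n}`. -/
def seriesA : PowerSeries (Module.End K (SymFun K)) :=
  PowerSeries.mk fun n => ∑ k ∈ Finset.range (n + 1),
    ((laurentPoch t k)⁻¹).coeff (n : ℤ) • opA q t k

end Operators

/-- The field `ℚ(q,t)`, realised as `ℚ(q)(t)` and carrying the `t`-adic topology. -/
abbrev QQqt : Type := RatFunc (RatFunc ℚ)

/-- The parameter `q`. -/
def qPar : QQqt := RatFunc.C RatFunc.X

/-- The parameter `t`. -/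
def tPar : QQqt := RatFunc.X

end MacdonaldLax

end

/-! The second identity comes first and implies the operator identity for power series.

Fix a vector `v`. Since `F` is homogeneous of degree zero, `S^(k) v` splits by degree `d` into the
sums of `coeffF (n - m) • Q_m Q_n^* v` over `|m| = |n| = d`, where `Q_m` is the product of the
one-row functions. The array `Q_m Q_n^* v` is symmetric in the entries of `m` and in those of `n`,
so only the matrix `G` of sums of `coeffF` over pairs of orbits `(λ, λ')` matters. This matrix is
diagonalized. Let `X λ μ` be the coefficient at `z^μ` of `m_λ F`. Since `(z_i - t z_{i+1}) m_λ F` is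
antisymmetric in `z_i, z_{i+1}` (`coeffF_antisymm`), the coefficients at arbitrary exponents can be
straightened to coefficients at partitions (`IsStraightening.sub_mem_span`). Summing over an orbit
gives `G = X C` with `C` triangular. Its diagonal entries are generating functions of rearrangements
by ascents, that is, the `t`-multinomials `(t;t)_k / b_μ` (`sum_pow_ascentCount`). Now `X` is
unitriangular, `C` is triangular in the opposite sense, and `G` is symmetric because `F` is
invariant under `z_i ↦ z_{k+1-i}⁻¹`. The uniqueness of the triangular factorization then forces `G =
X D Xᵀ` with `D` the diagonal of `C` (`mul_eq_mul_diagonal_mul_transpose`).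

Hence `S^(k)` is the sum of `q^{-|μ|} (t;t)_k / b_μ · Q_μ Q_μ^*` over partitions `μ` with at most
`k` parts, padded by zeros. Padding does not change `Q_μ`, and the `k - i` zeros of a partition with
`i` parts contribute `(t;t)_{k-i}` to `b_μ`. Grouping by `i` gives `opS_eq_sum_opA`.

For the power series identity put `v = u⁻¹`. Euler's expansion of `(v;t)_∞` (`eulerSeries`) and the
cancellation of the first `k` factors against `(u;t⁻¹)_k` show that the coefficient of `(v;t)_∞ /
(u;t⁻¹)_k` at `v^n` is `(t;t)_n / (t;t)_{n-k}` times a factor depending only on `n`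
(`coeff_eulerSeries_mul_invPoch`). The sum over `k` against `A^(k)` is therefore a multiple of
`S^(n)`. -/

namespace MacdonaldLax

/-! ### Coefficients of `F`: symmetries, support and stability. -/

section CoeffF

variable {K : Type*} [Field K] (t : K) {k : ℕ}

lemma ratioSeries_mul : ratioSeries t * (1 - PowerSeries.C t * PowerSeries.X) =
    1 - PowerSeries.X := by
  rw [ratioSeries, mul_assoc, PowerSeries.inv_mul_cancel, mul_one]
  simp

lemma coeff_zero_ratioSeries : PowerSeries.coeff 0 (ratioSeries t) = 1 := by
  simp [ratioSeries]

lemma coeff_succ_ratioSeries (n : ℕ) : PowerSeries.coeff (n + 1) (ratioSeries t) -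
    t * PowerSeries.coeff n (ratioSeries t) = if n = 0 then -1 else 0 := by
  have h := congrArg (PowerSeries.coeff (n + 1)) (ratioSeries_mul t)
  rw [mul_sub, mul_one, ← mul_assoc, map_sub, PowerSeries.coeff_succ_mul_X, mul_comm (ratioSeries t),
    PowerSeries.coeff_C_mul, map_sub, PowerSeries.coeff_one, PowerSeries.coeff_X] at h
  rw [h]
  by_cases hn : n = 0 <;> simp [hn]

/-- The coefficient of `∏ (z_j / z_i) ^ c(i,j)` in the expansion of `F`. -/
noncomputable def ratioWeight (c : PairLT k → ℕ) : K :=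
  ∏ p, PowerSeries.coeff (c p) (ratioSeries t)

lemma coeffF_eq_sum (a : Fin k → ℤ) :
    coeffF t a = ∑ c ∈ (ratioExponent_finite a).toFinset, ratioWeight t c :=
  finsum_mem_eq_finite_toFinset_sum _ _

lemma ratioExponent_add (c c' : PairLT k → ℕ) :
    ratioExponent (c + c') = ratioExponent c + ratioExponent c' := by
  simp [ratioExponent, add_smul, Finset.sum_add_distrib]

/-- The exponent vector of `z_j / z_i`. -/
def pairVec (p : PairLT k) : Fin k → ℤ := Pi.single p.1.2 1 - Pi.single p.1.1 1

lemma ratioExponent_single (p : PairLT k) : ratioExponent (Pi.single p 1) = pairVec p := by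
  rw [ratioExponent, Finset.sum_eq_single p]
  · simp [pairVec]
  · intro p' _ h
    simp [Pi.single_eq_of_ne h]
  · simp

lemma ratioExponent_eq (c : PairLT k → ℕ) : ratioExponent c = ∑ p, (c p : ℤ) • pairVec p := rfl

/-- The coefficients of the product of all factors of `F` other than the one indexed by `p₀`. -/
noncomputable def coeffOmit (p₀ : PairLT k) (a : Fin k → ℤ) : K :=
  ∑ c ∈ (ratioExponent_finite a).toFinset.filter (fun c => c p₀ = 0), ratioWeight t c

/-- Compare coefficients in `(1 - t z_j/z_i) F = (1 - z_j/z_i) F'`, where `F'` omits the factor of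
the pair `p₀ = (i, j)`; multiplication by `z_j/z_i` shifts exponents by `pairVec p₀`. -/
lemma coeffF_sub_mul (p₀ : PairLT k) (a : Fin k → ℤ) :
    coeffF t a - t * coeffF t (a - pairVec p₀) =
      coeffOmit t p₀ a - coeffOmit t p₀ (a - pairVec p₀) := by
  classical
  have hw (c : PairLT k → ℕ) : ratioWeight t c = PowerSeries.coeff (c p₀) (ratioSeries t) *
      ∏ p ∈ Finset.univ.erase p₀, PowerSeries.coeff (c p) (ratioSeries t) :=
    (Finset.mul_prod_erase _ _ (Finset.mem_univ _)).symm
  have h1 : ∑ c ∈ (ratioExponent_finite a).toFinset.filter (fun c => ¬ c p₀ = 0), ratioWeight t c =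
      ∑ c ∈ (ratioExponent_finite (a - pairVec p₀)).toFinset,
        ratioWeight t (c + Pi.single p₀ 1) := by
    symm
    refine Finset.sum_bij' (fun c _ => c + Pi.single p₀ 1) (fun c _ => c - Pi.single p₀ 1)
      ?_ ?_ ?_ ?_ ?_
    · intro c hc
      simp only [Set.Finite.mem_toFinset, Set.mem_ofPred_eq, Finset.mem_filter] at hc ⊢
      refine ⟨by rw [ratioExponent_add, hc, ratioExponent_single]; abel, by simp⟩
    · intro c hc
      simp only [Set.Finite.mem_toFinset, Set.mem_ofPred_eq, Finset.mem_filter] at hc ⊢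
      have h : c = c - Pi.single p₀ 1 + Pi.single p₀ 1 := by
        funext p
        by_cases hp : p = p₀
        · subst hp
          have := hc.2
          simp
          omega
        · simp [Pi.single_eq_of_ne hp]
      have h2 := hc.1
      rw [h, ratioExponent_add, ratioExponent_single] at h2
      rw [← h2]; abel
    · intro c _
      simp
    · intro c hc
      simp only [Set.Finite.mem_toFinset, Set.mem_ofPred_eq, Finset.mem_filter] at hc
      funext p
      by_cases hp : p = p₀
      · subst hp
        have := hc.2
        simp
        omega
      · simp [Pi.single_eq_of_ne hp]
    · intro c _
      rfl
  rw [coeffF_eq_sum, ← Finset.sum_filter_add_sum_filter_not _ (fun c => c p₀ = 0), h1,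
    coeffF_eq_sum, Finset.mul_sum, add_sub_assoc, ← Finset.sum_sub_distrib, coeffOmit,
    sub_eq_add_neg (Finset.sum _ _), add_right_inj, coeffOmit, Finset.sum_filter,
    ← Finset.sum_neg_distrib]
  refine Finset.sum_congr rfl fun c _ => ?_
  have h2 : ∏ p ∈ Finset.univ.erase p₀, PowerSeries.coeff ((c + Pi.single p₀ 1 : PairLT k → ℕ) p)
      (ratioSeries t) =
      ∏ p ∈ Finset.univ.erase p₀, PowerSeries.coeff (c p) (ratioSeries t) := by
    refine Finset.prod_congr rfl fun p hp => ?_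
    simp [Pi.single_eq_of_ne (Finset.ne_of_mem_erase hp)]
  rw [hw, hw, h2, ← mul_assoc, ← sub_mul]
  have h3 : (c + Pi.single p₀ 1 : PairLT k → ℕ) p₀ = c p₀ + 1 := by simp
  rw [h3, coeff_succ_ratioSeries]
  split_ifs with h
  · rw [h, coeff_zero_ratioSeries]; ring
  · simp

lemma swap_lt_swap {i j : Fin k} (hij : (j : ℕ) = i + 1) {a b : Fin k} (hab : a < b)
    (hne : ¬ (a = i ∧ b = j)) : Equiv.swap i j a < Equiv.swap i j b := by
  rw [Equiv.swap_apply_def, Equiv.swap_apply_def]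
  simp only [Fin.lt_def, Fin.ext_iff] at *
  split_ifs <;> simp_all <;> omega

/-- The permutation of the pairs other than `(i, i + 1)` induced by the transposition of `i` and
`i + 1`. -/
def swapPair {i j : Fin k} (hij : (j : ℕ) = i + 1) (p : PairLT k) : PairLT k :=
  if h : p.1.1 = i ∧ p.1.2 = j then p
  else ⟨(Equiv.swap i j p.1.1, Equiv.swap i j p.1.2), swap_lt_swap hij p.2 h⟩

lemma swapPair_involutive {i j : Fin k} (hij : (j : ℕ) = i + 1) :
    Function.Involutive (swapPair hij) := by
  intro p
  by_cases h : p.1.1 = i ∧ p.1.2 = j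
  · rw [swapPair, swapPair, dif_pos h, dif_pos h]
  · have h' : ¬ ((swapPair hij p).1.1 = i ∧ (swapPair hij p).1.2 = j) := by
      rw [swapPair, dif_neg h]
      rintro ⟨h1, h2⟩
      have h3 := congrArg (Equiv.swap i j) h1
      have h4 := congrArg (Equiv.swap i j) h2
      simp only [Equiv.swap_apply_self, Equiv.swap_apply_left, Equiv.swap_apply_right] at h3 h4
      have := p.2
      rw [h3, h4, Fin.lt_def] at this
      omega
    conv_lhs => rw [swapPair, dif_neg h']
    ext <;> simp [swapPair, dif_neg h]

lemma pairVec_swapPair {i j : Fin k} (hij : (j : ℕ) = i + 1) {p : PairLT k}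
    (hp : ¬ (p.1.1 = i ∧ p.1.2 = j)) : pairVec (swapPair hij p) = pairVec p ∘ Equiv.swap i j := by
  rw [swapPair, dif_neg hp]
  funext l
  simp [pairVec, Pi.single_apply, Equiv.swap_apply_eq_iff]

lemma ratioExponent_comp_equiv (c : PairLT k → ℕ) (σ : Equiv.Perm (PairLT k)) :
    ratioExponent (c ∘ σ) = ∑ p, (c p : ℤ) • pairVec (σ.symm p) := by
  rw [ratioExponent_eq, ← Equiv.sum_comp σ fun p => (c p : ℤ) • pairVec (σ.symm p)]
  simp only [Function.comp, Equiv.symm_apply_apply]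

lemma ratioWeight_comp_equiv (c : PairLT k → ℕ) (σ : Equiv.Perm (PairLT k)) :
    ratioWeight t (c ∘ σ) = ratioWeight t c :=
  Equiv.prod_comp σ fun p => PowerSeries.coeff (c p) (ratioSeries t)

/-- An adjacent transposition preserves the order of every pair except `(i, j)` itself, so it merely
permutes the remaining factors of `F`. -/
lemma coeffOmit_swap {i j : Fin k} (hij : (j : ℕ) = i + 1) (a : Fin k → ℤ) :
    coeffOmit t ⟨(i, j), Fin.lt_def.2 (by simp only; omega)⟩ (a ∘ Equiv.swap i j) =
      coeffOmit t ⟨(i, j), Fin.lt_def.2 (by simp only; omega)⟩ a := by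
  set p₀ : PairLT k := ⟨(i, j), Fin.lt_def.2 (by simp only; omega)⟩ with hp₀
  let σ : Equiv.Perm (PairLT k) := (swapPair_involutive hij).toPerm
  have hσ₀ : σ p₀ = p₀ := by
    change swapPair hij p₀ = p₀
    rw [swapPair, dif_pos ⟨rfl, rfl⟩]
  have hexp (c : PairLT k → ℕ) (hc : c p₀ = 0) :
      ratioExponent (c ∘ σ) = ratioExponent c ∘ Equiv.swap i j := by
    rw [ratioExponent_comp_equiv, ratioExponent_eq]
    funext l
    simp only [Function.comp, Finset.sum_apply, Pi.smul_apply]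
    refine Finset.sum_congr rfl fun p _ => ?_
    by_cases hp : p.1.1 = i ∧ p.1.2 = j
    · have : p = p₀ := Subtype.ext (Prod.ext hp.1 hp.2)
      rw [this, hc]
      simp
    · have := congrFun (pairVec_swapPair hij hp) l
      rw [Function.comp] at this
      rw [← this]
      rfl
  have hinv (c : PairLT k → ℕ) : (c ∘ σ) ∘ σ = c := by
    funext p
    exact congrArg c (swapPair_involutive hij p)
  have hmem (a : Fin k → ℤ) (c : PairLT k → ℕ)
      (hc : c ∈ (ratioExponent_finite a).toFinset.filter (fun c => c p₀ = 0)) :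
      c ∘ σ ∈ (ratioExponent_finite (a ∘ Equiv.swap i j)).toFinset.filter
        (fun c => c p₀ = 0) := by
    simp only [Set.Finite.mem_toFinset, Set.mem_ofPred_eq, Finset.mem_filter] at hc ⊢
    refine ⟨by rw [hexp c hc.2, hc.1], by rw [Function.comp, hσ₀, hc.2]⟩
  symm
  refine Finset.sum_bij' (fun c _ => c ∘ σ) (fun c _ => c ∘ σ) (hmem a) ?_
    (fun c _ => hinv c) (fun c _ => hinv c) (fun c _ => (ratioWeight_comp_equiv t c σ).symm)
  intro c hc
  have h := hmem _ c hc
  have h2 : (a ∘ Equiv.swap i j) ∘ Equiv.swap i j = a := by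
    funext l; simp
  rwa [h2] at h

/-- `(z_i - t z_{i+1}) F` is antisymmetric in the variables `z_i` and `z_{i+1}`. -/
lemma coeffF_antisymm {i j : Fin k} (hij : (j : ℕ) = i + 1) (a : Fin k → ℤ) :
    coeffF t (a - Pi.single i 1) - t * coeffF t (a - Pi.single j 1) =
      -(coeffF t (a ∘ Equiv.swap i j - Pi.single i 1) -
        t * coeffF t (a ∘ Equiv.swap i j - Pi.single j 1)) := by
  have hlt : i < j := Fin.lt_def.2 (by omega)
  -- In series terms, `(z_i - t z_j) F` equals `z_i - z_j`, which is antisymmetric, times the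
  -- product of the other factors, which is symmetric in `z_i, z_j`.
  have h (a : Fin k → ℤ) : coeffF t (a - Pi.single i 1) - t * coeffF t (a - Pi.single j 1) =
      coeffOmit t ⟨(i, j), hlt⟩ (a - Pi.single i 1) -
        coeffOmit t ⟨(i, j), hlt⟩ (a - Pi.single j 1) := by
    have h := coeffF_sub_mul t ⟨(i, j), hlt⟩ (a - Pi.single i 1)
    have h1 : a - Pi.single i 1 - pairVec ⟨(i, j), hlt⟩ = a - Pi.single j 1 := by
      simp only [pairVec]; abel
    rwa [h1] at h
  have hs : (Pi.single i 1 : Fin k → ℤ) ∘ Equiv.swap i j = Pi.single j 1 := by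
    funext l
    simp [Pi.single_apply, Equiv.swap_apply_eq_iff]
  have hs' : (Pi.single j 1 : Fin k → ℤ) ∘ Equiv.swap i j = Pi.single i 1 := by
    funext l
    simp [Pi.single_apply, Equiv.swap_apply_eq_iff]
  have h1 := coeffOmit_swap t hij (a - Pi.single i 1)
  have h2 := coeffOmit_swap t hij (a - Pi.single j 1)
  have h3 : (a - Pi.single i 1) ∘ Equiv.swap i j = a ∘ Equiv.swap i j - Pi.single j 1 := by
    rw [← hs]; rfl
  have h4 : (a - Pi.single j 1) ∘ Equiv.swap i j = a ∘ Equiv.swap i j - Pi.single i 1 := by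
    rw [← hs']; rfl
  rw [h3] at h1
  rw [h4] at h2
  rw [h, h, h1, h2]
  ring

/-- `F` is invariant under `z_i ↦ z_{k+1-i}⁻¹`. -/
lemma coeffF_neg_rev (a : Fin k → ℤ) : coeffF t (fun i => -a i.rev) = coeffF t a := by
  let τ : PairLT k → PairLT k := fun p => ⟨(p.1.2.rev, p.1.1.rev), Fin.rev_lt_rev.2 p.2⟩
  have hτ : Function.Involutive τ := fun p => by ext <;> simp [τ]
  let σ : Equiv.Perm (PairLT k) := hτ.toPerm
  have hexp (c : PairLT k → ℕ) : ratioExponent (c ∘ σ) = fun i => -ratioExponent c i.rev := by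
    rw [ratioExponent_comp_equiv, ratioExponent_eq]
    funext l
    simp only [Finset.sum_apply, Pi.smul_apply, ← Finset.sum_neg_distrib]
    refine Finset.sum_congr rfl fun p _ => ?_
    change (c p : ℤ) • pairVec (τ p) l = _
    have h (x : Fin k) : l = x.rev ↔ l.rev = x := by rw [← Fin.rev_inj, Fin.rev_rev]
    simp only [pairVec, τ, Pi.sub_apply, Pi.single_apply, h, smul_eq_mul]
    ring
  have hinv (c : PairLT k → ℕ) : (c ∘ σ) ∘ σ = c := by
    funext p
    exact congrArg c (hτ p)
  have hmem (a : Fin k → ℤ) (c : PairLT k → ℕ) (hc : c ∈ (ratioExponent_finite a).toFinset) :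
      c ∘ σ ∈ (ratioExponent_finite (fun i => -a i.rev)).toFinset := by
    simp only [Set.Finite.mem_toFinset, Set.mem_ofPred_eq] at hc ⊢
    rw [hexp, hc]
  rw [coeffF_eq_sum, coeffF_eq_sum]
  symm
  refine Finset.sum_bij' (fun c _ => c ∘ σ) (fun c _ => c ∘ σ) (hmem a) ?_
    (fun c _ => hinv c) (fun c _ => hinv c) (fun c _ => (ratioWeight_comp_equiv t c σ).symm)
  intro c hc
  simpa using hmem _ c hc

/-- Every bound on the support of `F` comes from a choice of weights here: `w l = l` gives
positivity, and a weakly decreasing `w` gives the dominance inequality. -/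
lemma sum_mul_ratioExponent (w : Fin k → ℤ) (c : PairLT k → ℕ) :
    ∑ l, w l * ratioExponent c l = ∑ p : PairLT k, (c p : ℤ) * (w p.1.2 - w p.1.1) := by
  simp only [ratioExponent_eq, Finset.sum_apply, Pi.smul_apply, smul_eq_mul, Finset.mul_sum]
  rw [Finset.sum_comm]
  refine Finset.sum_congr rfl fun p _ => ?_
  simp only [mul_left_comm _ (c p : ℤ), ← Finset.mul_sum]
  simp [pairVec, mul_sub, Finset.sum_sub_distrib, Pi.single_apply]

lemma eq_zero_of_ratioExponent_eq_zero {c : PairLT k → ℕ} (h : ratioExponent c = 0) : c = 0 := by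
  have h1 := sum_mul_ratioExponent (fun l => (l : ℤ)) c
  rw [h] at h1
  simp only [Pi.zero_apply, mul_zero, Finset.sum_const_zero] at h1
  have hpos (p : PairLT k) : (0 : ℤ) < (p.1.2 : ℕ) - (p.1.1 : ℕ) := by
    have : (p.1.1 : ℕ) < (p.1.2 : ℕ) := p.2
    omega
  have h2 := (Finset.sum_eq_zero_iff_of_nonneg fun p _ =>
    mul_nonneg (Int.natCast_nonneg (c p)) (hpos p).le).1 h1.symm
  funext p
  have h3 := h2 p (Finset.mem_univ _)
  rcases mul_eq_zero.1 h3 with h3 | h3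
  · exact_mod_cast h3
  · exact absurd h3 (hpos p).ne'

lemma coeffF_zero : coeffF t (0 : Fin k → ℤ) = 1 := by
  rw [coeffF_eq_sum, Finset.sum_eq_single (0 : PairLT k → ℕ)]
  · simp [ratioWeight, ratioSeries]
  · intro c hc hne
    exact absurd (eq_zero_of_ratioExponent_eq_zero (by simpa using hc)) hne
  · intro h
    exact absurd (by simp [ratioExponent]) h

lemma exists_of_coeffF_ne_zero {a : Fin k → ℤ} (h : coeffF t a ≠ 0) :
    ∃ c : PairLT k → ℕ, ratioExponent c = a := by
  obtain ⟨c, hc⟩ := exists_ne_zero_of_finsum_mem_ne_zero h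
  exact ⟨c, hc.1⟩

/-- Since `μ - α` is a nonnegative combination of vectors `e_j - e_i` with `i < j` and `μ`
decreases, `⟨μ, μ - α⟩ ≤ 0`. Expanding `|α|² = |μ - (μ - α)|²` then gives `|α|² ≥ |μ|² + |μ - α|²`.
The sum of squares thus replaces the dominance order in all triangularity arguments. -/
lemma eq_or_lt_of_coeffF_ne_zero {μ α : Fin k → ℕ} (hμ : Antitone μ)
    (h : coeffF t (fun i => (μ i : ℤ) - α i) ≠ 0) : α = μ ∨ ∑ i, μ i ^ 2 < ∑ i, α i ^ 2 := by
  obtain ⟨c, hc⟩ := exists_of_coeffF_ne_zero t h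
  have h1 := sum_mul_ratioExponent (fun l => (μ l : ℤ)) c
  rw [hc] at h1
  have h2 : ∑ p : PairLT k, (c p : ℤ) * ((μ p.1.2 : ℤ) - μ p.1.1) ≤ 0 := by
    refine Finset.sum_nonpos fun p _ => mul_nonpos_of_nonneg_of_nonpos (by positivity) ?_
    have := hμ p.2.le
    omega
  have h3 : ∑ i, (α i : ℤ) ^ 2 = ∑ i, (μ i : ℤ) ^ 2 - 2 * ∑ i, (μ i : ℤ) * ((μ i : ℤ) - α i) +
      ∑ i, ((μ i : ℤ) - α i) ^ 2 := by
    rw [Finset.mul_sum, ← Finset.sum_sub_distrib, ← Finset.sum_add_distrib]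
    exact Finset.sum_congr rfl fun i _ => by ring
  by_cases h4 : ∑ i, ((μ i : ℤ) - α i) ^ 2 = 0
  · left
    funext i
    have := (Finset.sum_eq_zero_iff_of_nonneg fun i _ => sq_nonneg _).1 h4 i (Finset.mem_univ _)
    have := pow_eq_zero_iff (two_ne_zero) |>.1 this
    omega
  · right
    have h5 : 0 < ∑ i, ((μ i : ℤ) - α i) ^ 2 :=
      lt_of_le_of_ne (Finset.sum_nonneg fun i _ => sq_nonneg _) (Ne.symm h4)
    have : ∑ i, (μ i : ℤ) ^ 2 < ∑ i, (α i : ℤ) ^ 2 := by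
      rw [h3, h1]; linarith
    exact_mod_cast this

lemma ratioExponent_last (c : PairLT (k + 1) → ℕ) : ratioExponent c (Fin.last k) =
    ∑ p : PairLT (k + 1), if p.1.2 = Fin.last k then (c p : ℤ) else 0 := by
  simp only [ratioExponent_eq, Finset.sum_apply, Pi.smul_apply, smul_eq_mul]
  refine Finset.sum_congr rfl fun p _ => ?_
  have h : p.1.1 ≠ Fin.last k := (lt_of_lt_of_le p.2 (Fin.le_last _)).ne
  simp [pairVec, Pi.single_apply, h.symm, eq_comm]

lemma last_nonneg_of_coeffF_ne_zero {a : Fin (k + 1) → ℤ} (h : coeffF t a ≠ 0) :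
    0 ≤ a (Fin.last k) := by
  obtain ⟨c, hc⟩ := exists_of_coeffF_ne_zero t h
  rw [← hc, ratioExponent_last]
  exact Finset.sum_nonneg fun p _ => by split_ifs <;> positivity

/-- Pairs in `Fin k` as pairs in `Fin (k + 1)`. -/
def pairCastSucc (p : PairLT k) : PairLT (k + 1) :=
  ⟨(p.1.1.castSucc, p.1.2.castSucc), Fin.castSucc_lt_castSucc_iff.2 p.2⟩

lemma pairCastSucc_injective : Function.Injective (pairCastSucc (k := k)) := by
  intro p p' h
  have h1 : p.1.1.castSucc = p'.1.1.castSucc := congrArg (fun x => x.1.1) h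
  have h2 : p.1.2.castSucc = p'.1.2.castSucc := congrArg (fun x => x.1.2) h
  exact Subtype.ext (Prod.ext (Fin.castSucc_injective _ h1) (Fin.castSucc_injective _ h2))

lemma mem_range_pairCastSucc (p : PairLT (k + 1)) :
    p ∈ Set.range (pairCastSucc (k := k)) ↔ p.1.2 ≠ Fin.last k := by
  constructor
  · rintro ⟨p, rfl⟩
    exact (Fin.castSucc_lt_last _).ne
  · intro h
    have h' : p.1.1 ≠ Fin.last k := (lt_of_lt_of_le p.2 (Fin.le_last _)).ne
    refine ⟨⟨(p.1.1.castPred h', p.1.2.castPred h), by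
      simpa using p.2⟩, by ext <;> simp [pairCastSucc]⟩

/-- The last variable occurs only in numerators of the ratios, so exponent zero there forces every
factor involving it to contribute its constant term `1`. -/
lemma coeffF_snoc_zero (a : Fin k → ℤ) :
    coeffF t (Fin.snoc a 0 : Fin (k + 1) → ℤ) = coeffF t a := by
  classical
  let ext (c : PairLT k → ℕ) : PairLT (k + 1) → ℕ := Function.extend pairCastSucc c 0
  have hsum {M : Type _} [AddCommMonoid M] (f : PairLT (k + 1) → M)
      (hf : ∀ p, p.1.2 = Fin.last k → f p = 0) : ∑ p, f p = ∑ p, f (pairCastSucc p) := by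
    rw [← Finset.sum_subset (Finset.subset_univ (Finset.univ.map ⟨_, pairCastSucc_injective⟩)),
      Finset.sum_map]
    · rfl
    · intro p _ hp
      refine hf p ?_
      by_contra hc
      obtain ⟨p', rfl⟩ := (mem_range_pairCastSucc p).2 hc
      exact hp (Finset.mem_map.2 ⟨p', Finset.mem_univ _, rfl⟩)
  have hlast (c : PairLT k → ℕ) (p : PairLT (k + 1)) (hp : p.1.2 = Fin.last k) : ext c p = 0 :=
    Function.extend_apply' _ _ _ fun h => (mem_range_pairCastSucc p).1 h hp
  have happ (c : PairLT k → ℕ) (p : PairLT k) : ext c (pairCastSucc p) = c p :=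
    pairCastSucc_injective.extend_apply _ _ _
  have hexp (c : PairLT k → ℕ) : ratioExponent (ext c) = Fin.snoc (ratioExponent c) 0 := by
    funext l
    refine Fin.lastCases ?_ (fun l => ?_) l
    · rw [Fin.snoc_last, ratioExponent_last]
      refine Finset.sum_eq_zero fun p _ => ?_
      split_ifs with h
      · rw [hlast c p h]; rfl
      · rfl
    · rw [Fin.snoc_castSucc, ratioExponent_eq, hsum _ fun p hp => by rw [hlast c p hp]; simp,
        ratioExponent_eq]
      simp only [Finset.sum_apply, happ]
      refine Finset.sum_congr rfl fun p _ => ?_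
      simp [pairVec, Pi.single_apply, pairCastSucc]
  have hwt (c : PairLT k → ℕ) : ratioWeight t (ext c) = ratioWeight t c := by
    rw [ratioWeight, ratioWeight, ← Finset.prod_subset (Finset.subset_univ
      (Finset.univ.map ⟨_, pairCastSucc_injective⟩)), Finset.prod_map]
    · refine Finset.prod_congr rfl fun p _ => ?_
      exact congrArg (fun n => PowerSeries.coeff n (ratioSeries t)) (happ c p)
    · intro p _ hp
      rw [hlast c p, coeff_zero_ratioSeries]
      by_contra hc
      obtain ⟨p', rfl⟩ := (mem_range_pairCastSucc p).2 hc
      exact hp (Finset.mem_map.2 ⟨p', Finset.mem_univ _, rfl⟩)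
  rw [coeffF_eq_sum, coeffF_eq_sum]
  symm
  refine Finset.sum_bij' (fun c _ => ext c) (fun c _ => c ∘ pairCastSucc) ?_ ?_ ?_ ?_ ?_
  · intro c hc
    simp only [Set.Finite.mem_toFinset, Set.mem_ofPred_eq] at hc ⊢
    rw [hexp, hc]
  · intro c hc
    simp only [Set.Finite.mem_toFinset, Set.mem_ofPred_eq] at hc ⊢
    funext l
    have h := congrFun hc l.castSucc
    rw [Fin.snoc_castSucc] at h
    have h0 := congrFun hc (Fin.last k)
    rw [Fin.snoc_last, ratioExponent_last] at h0
    rw [← h, ratioExponent_eq, ratioExponent_eq, Finset.sum_apply, Finset.sum_apply, hsum]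
    · refine Finset.sum_congr rfl fun p _ => ?_
      simp [pairVec, Pi.single_apply, pairCastSucc]
    · intro p hp
      have h1 := (Finset.sum_eq_zero_iff_of_nonneg fun p _ => by split_ifs <;> positivity).1 h0 p
        (Finset.mem_univ _)
      rw [if_pos hp] at h1
      rw [Pi.smul_apply, h1, zero_smul]
  · intro c _
    funext p
    exact happ c p
  · intro c hc
    simp only [Set.Finite.mem_toFinset, Set.mem_ofPred_eq] at hc
    have h0 := congrFun hc (Fin.last k)
    rw [Fin.snoc_last, ratioExponent_last] at h0
    funext p
    by_cases hp : p.1.2 = Fin.last k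
    · have h1 := (Finset.sum_eq_zero_iff_of_nonneg fun p _ => by split_ifs <;> positivity).1 h0 p
        (Finset.mem_univ _)
      rw [if_pos hp] at h1
      rw [hlast _ p hp]
      exact_mod_cast h1.symm
    · obtain ⟨p', rfl⟩ := (mem_range_pairCastSucc p).2 hp
      exact happ _ p'
  · intro c _
    exact (hwt c).symm

end CoeffF

/-! ### Straightening tuples to partitions. -/

section Sorting

variable {k : ℕ}

/-- The rearrangement of a tuple in weakly decreasing order. -/
def sortDesc (α : Fin k → ℕ) : Fin k → ℕ := (α ∘ Tuple.sort α) ∘ Fin.rev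

lemma antitone_sortDesc (α : Fin k → ℕ) : Antitone (sortDesc α) := fun _ _ h =>
  Tuple.monotone_sort α (Fin.rev_le_rev.2 h)

lemma sortDesc_comp_perm (α : Fin k → ℕ) (σ : Equiv.Perm (Fin k)) :
    sortDesc (α ∘ σ) = sortDesc α := by
  rw [sortDesc, Tuple.comp_perm_comp_sort_eq_comp_sort, sortDesc]

lemma exists_sortDesc_eq_comp (α : Fin k → ℕ) : ∃ σ : Equiv.Perm (Fin k), sortDesc α = α ∘ σ :=
  ⟨Fin.revPerm.trans (Tuple.sort α), rfl⟩

lemma sortDesc_of_antitone {α : Fin k → ℕ} (h : Antitone α) : sortDesc α = α := by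
  have h1 : α ∘ Fin.revPerm = α ∘ Tuple.sort α :=
    Tuple.comp_sort_eq_comp_iff_monotone.2 fun _ _ h' => h (Fin.rev_le_rev.2 h')
  rw [sortDesc, ← h1]
  funext i
  simp

lemma sum_comp_sortDesc {M : Type*} [AddCommMonoid M] (α : Fin k → ℕ) (f : ℕ → M) :
    ∑ i, f (sortDesc α i) = ∑ i, f (α i) := by
  obtain ⟨σ, hσ⟩ := exists_sortDesc_eq_comp α
  rw [hσ]
  exact Equiv.sum_comp σ fun i => f (α i)

/-- The number of pairs of positions `i < j` with `α i < α j`. -/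
def ascentCount (α : Fin k → ℕ) : ℕ := ∑ i, ∑ j, if i < j ∧ α i < α j then 1 else 0

lemma ascentCount_eq_zero {α : Fin k → ℕ} (h : Antitone α) : ascentCount α = 0 := by
  refine Finset.sum_eq_zero fun i _ => Finset.sum_eq_zero fun j _ => if_neg ?_
  rintro ⟨h1, h2⟩
  exact absurd (h h1.le) (not_le.2 h2)

/-- The adjacent transposition keeps the relative position of all other pairs and removes only the
ascent `(i, j)`. -/
lemma ascentCount_swap {α : Fin k → ℕ} {i j : Fin k} (hij : (j : ℕ) = i + 1) (h : α i < α j) :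
    ascentCount α = ascentCount (α ∘ Equiv.swap i j) + 1 := by
  have hne : i ≠ j := by rintro rfl; omega
  have h1 : ascentCount (α ∘ Equiv.swap i j) = ∑ a, ∑ b,
      if Equiv.swap i j a < Equiv.swap i j b ∧ α a < α b then 1 else 0 := by
    rw [ascentCount, ← Equiv.sum_comp (Equiv.swap i j)]
    refine Finset.sum_congr rfl fun a _ => ?_
    rw [← Equiv.sum_comp (Equiv.swap i j)]
    simp
  have h2 : (1 : ℕ) = ∑ a, ∑ b, if a = i ∧ b = j then 1 else 0 := by
    rw [Finset.sum_eq_single i, Finset.sum_eq_single j] <;> simp +contextual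
  rw [h1]
  refine Eq.trans ?_ (congrArg (_ + ·) h2.symm)
  rw [← Finset.sum_add_distrib, ascentCount]
  refine Finset.sum_congr rfl fun a _ => ?_
  rw [← Finset.sum_add_distrib]
  refine Finset.sum_congr rfl fun b _ => ?_
  by_cases hab : α a < α b
  · by_cases h3 : a = i ∧ b = j
    · obtain ⟨rfl, rfl⟩ := h3
      have h4 : a < b := Fin.lt_def.2 (by omega)
      simp [h, h4, h4.le]
    · have h4 : ¬ (a = j ∧ b = i) := by
        rintro ⟨rfl, rfl⟩
        omega
      have h5 : a ≠ b := by rintro rfl; omega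
      have h6 : (Equiv.swap i j a < Equiv.swap i j b) ↔ a < b := by
        constructor
        · intro h7
          have h8 := swap_lt_swap hij h7 (by
            rintro ⟨h8, h9⟩
            rw [Equiv.swap_apply_eq_iff, Equiv.swap_apply_left] at h8
            rw [Equiv.swap_apply_eq_iff, Equiv.swap_apply_right] at h9
            exact h4 ⟨h8, h9⟩)
          simpa using h8
        · intro h7
          exact swap_lt_swap hij h7 h3
      simp [h6, hab, h3]
  · have h3 : ¬ (a = i ∧ b = j) := by
      rintro ⟨rfl, rfl⟩
      exact hab h
    simp [hab, h3]

lemma exists_ascent {α : Fin k → ℕ} (h : ¬ Antitone α) :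
    ∃ i j : Fin k, (j : ℕ) = i + 1 ∧ α i < α j := by
  by_contra! hc
  refine h ?_
  rcases k with _ | k
  · exact fun i => i.elim0
  · exact Fin.antitone_iff_succ_le.2 fun i => hc i.castSucc i.succ (by simp)

lemma sum_eq_add_of_adjacent {M : Type*} [AddCommMonoid M] (f : Fin k → M) {i j : Fin k}
    (h : i ≠ j) : ∑ l, f l = f i + f j + ∑ l ∈ (Finset.univ.erase i).erase j, f l := by
  rw [← Finset.add_sum_erase _ f (Finset.mem_univ i), ← Finset.add_sum_erase _ f
    (Finset.mem_erase.2 ⟨h.symm, Finset.mem_univ j⟩), add_assoc]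

/-- Replacing the entries in the positions `i` and `j`. -/
def update₂ (α : Fin k → ℕ) (i j : Fin k) (a b : ℕ) : Fin k → ℕ :=
  Function.update (Function.update α i a) j b

lemma sum_update₂ {M : Type*} [AddCommMonoid M] (f : ℕ → M) (α : Fin k → ℕ) {i j : Fin k}
    (h : i ≠ j) (a b : ℕ) : ∑ l, f (update₂ α i j a b l) =
      f a + f b + ∑ l ∈ (Finset.univ.erase i).erase j, f (α l) := by
  rw [sum_eq_add_of_adjacent _ h]
  congr 1
  · simp [update₂, Function.update_of_ne h]
  · refine Finset.sum_congr rfl fun l hl => ?_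
    simp only [Finset.mem_erase] at hl
    rw [update₂, Function.update_of_ne hl.1, Function.update_of_ne hl.2.1]

/-- The relations satisfied by the coefficients of a series in `z_1, …, z_k` that becomes
antisymmetric in `z_i` and `z_{i+1}` when multiplied by `z_i - t z_{i+1}`. -/
def IsStraightening {K M : Type*} [Field K] [AddCommGroup M] [Module K M] (t : K)
    (X : (Fin k → ℕ) → M) : Prop :=
  ∀ (α : Fin k → ℕ) (i j : Fin k), (j : ℕ) = i + 1 → ∀ a b : ℕ,
    X (update₂ α i j a (b + 1)) + X (update₂ α i j b (a + 1)) =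
      t • (X (update₂ α i j (a + 1) b) + X (update₂ α i j (b + 1) a))

/-- Bubble sort: each relation exchanges an adjacent ascent at the cost of a factor `t`, modulo
terms whose two entries are closer together and hence have smaller sum of squares. The outer
induction is on the sum of squares, the inner one on the number of ascents. -/
lemma IsStraightening.sub_mem_span {K M : Type*} [Field K] [CharZero K] [AddCommGroup M]
    [Module K M] {t : K} {X : (Fin k → ℕ) → M} (hX : IsStraightening t X) (α : Fin k → ℕ) :
    X α - t ^ ascentCount α • X (sortDesc α) ∈ Submodule.span K
      (X '' {ν | Antitone ν ∧ ∑ i, ν i = ∑ i, α i ∧ ∑ i, ν i ^ 2 < ∑ i, α i ^ 2}) := by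
  let L (d n : ℕ) : Submodule K M :=
    Submodule.span K (X '' {ν | Antitone ν ∧ ∑ i, ν i = d ∧ ∑ i, ν i ^ 2 < n})
  change _ ∈ L (∑ i, α i) (∑ i, α i ^ 2)
  have hmono (d : ℕ) {m n : ℕ} (h : m ≤ n) : L d m ≤ L d n := by
    refine Submodule.span_mono (Set.image_mono ?_)
    rintro ν ⟨h1, h2, h3⟩
    exact ⟨h1, h2, h3.trans_le h⟩
  induction hn : ∑ i, α i ^ 2 using Nat.strong_induction_on generalizing α with
  | _ n ih =>
  -- This packages the outer induction hypothesis. It depends on `α` only through its sum, which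
  -- sorting preserves, so it survives the inner induction.
  have hlow (β : Fin k → ℕ) (h1 : ∑ i, β i = ∑ i, α i) (h2 : ∑ i, β i ^ 2 < n) :
      X β ∈ L (∑ i, α i) n := by
    have h3 := hmono _ h2.le (ih _ h2 β rfl)
    rw [h1] at h3
    have h4 : X (sortDesc β) ∈ L (∑ i, α i) n := by
      refine Submodule.subset_span ⟨_, ⟨antitone_sortDesc β, ?_, ?_⟩, rfl⟩
      · rw [← h1]; exact sum_comp_sortDesc β id
      · rwa [sum_comp_sortDesc β fun x => x ^ 2]
    have := add_mem h3 (Submodule.smul_mem _ (t ^ ascentCount β) h4)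
    rwa [sub_add_cancel] at this
  clear ih
  induction hm : ascentCount α generalizing α with
  | zero =>
    have h : Antitone α := by
      by_contra hc
      obtain ⟨i, j, hij, h⟩ := exists_ascent hc
      have := ascentCount_swap hij h
      omega
    rw [sortDesc_of_antitone h, pow_zero, one_smul, sub_self]
    exact zero_mem _
  | succ m ihm =>
    obtain ⟨i, j, hij, h⟩ : ∃ i j : Fin k, (j : ℕ) = i + 1 ∧ α i < α j := by
      refine exists_ascent fun hc => ?_
      rw [ascentCount_eq_zero hc] at hm
      omega
    have hne : i ≠ j := by rintro rfl; omega
    obtain ⟨a, ha⟩ : ∃ a, α j = a + 1 := ⟨α j - 1, by omega⟩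
    have hα : update₂ α i j (α i) (a + 1) = α := by
      rw [update₂, ← ha]; simp
    have hs : update₂ α i j (a + 1) (α i) = α ∘ Equiv.swap i j := by
      funext l
      simp only [update₂, Function.update_apply, Function.comp, Equiv.swap_apply_def, ← ha]
      split_ifs <;> simp_all
    have hrel := hX α i j hij (α i) a
    rw [hα, hs] at hrel
    have hcount := ascentCount_swap hij h
    have hsum : ∑ l, (α ∘ Equiv.swap i j) l = ∑ l, α l := Equiv.sum_comp (Equiv.swap i j) α
    have hsq : ∑ l, (α ∘ Equiv.swap i j) l ^ 2 = ∑ l, α l ^ 2 :=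
      Equiv.sum_comp (Equiv.swap i j) fun l => α l ^ 2
    have h1 := ihm (α ∘ Equiv.swap i j) (hsq.trans hn) (by rw [hsum]; exact hlow) (by omega)
    rw [hsum, sortDesc_comp_perm] at h1
    suffices h2 : X α - t • X (α ∘ Equiv.swap i j) ∈ L (∑ i, α i) n by
      have h3 := add_mem h2 (Submodule.smul_mem _ t h1)
      rw [smul_sub, smul_smul, ← pow_succ'] at h3
      convert h3 using 1
      abel
    -- If the two entries differ by one, the correction terms coincide with the main ones and the
    -- relation is doubled, so `2` has to be cancelled.
    by_cases hai : a = α i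
    · have e1 := congrArg (fun x => update₂ α i j x (a + 1)) hai
      have e2 := congrArg (fun x => update₂ α i j (a + 1) x) hai
      simp only [hα, hs] at e1 e2
      rw [← hai, e1, e2] at hrel
      have h2 : (2 : K) • (X α - t • X (α ∘ Equiv.swap i j)) = 0 := by
        rw [smul_sub, two_smul, hrel, two_smul, smul_add, sub_self]
      rw [(smul_eq_zero.1 h2).resolve_left two_ne_zero]
      exact zero_mem _
    · have hlt : α i < a := by omega
      have e1 : ∑ l, α l = α i + (a + 1) + ∑ l ∈ (Finset.univ.erase i).erase j, α l := by
        rw [sum_eq_add_of_adjacent _ hne, ha]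
      have e2 : ∑ l, α l ^ 2 = α i ^ 2 + (a + 1) ^ 2 +
          ∑ l ∈ (Finset.univ.erase i).erase j, α l ^ 2 := by
        rw [sum_eq_add_of_adjacent _ hne, ha]
      have h2 : X (update₂ α i j a (α i + 1)) ∈ L (∑ i, α i) n := by
        refine hlow _ ?_ ?_
        · have := sum_update₂ id α hne a (α i + 1)
          simp only [id] at this
          rw [this, e1]; omega
        · rw [← hn, e2, sum_update₂ (fun x => x ^ 2) α hne]
          nlinarith
      have h3 : X (update₂ α i j (α i + 1) a) ∈ L (∑ i, α i) n := by
        refine hlow _ ?_ ?_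
        · have := sum_update₂ id α hne (α i + 1) a
          simp only [id] at this
          rw [this, e1]; omega
        · rw [← hn, e2, sum_update₂ (fun x => x ^ 2) α hne]
          nlinarith
      have h4 := sub_mem (Submodule.smul_mem _ t h3) h2
      convert h4 using 1
      rw [smul_add] at hrel
      have h5 := sub_eq_of_eq_add hrel.symm
      rw [sub_eq_sub_iff_add_eq_add, hrel]

end Sorting

/-! ### Ascents of rearrangements and `t`-multinomial coefficients. -/

section Multinomial

variable {K : Type*} [Field K] (t : K)

/-- `∏ (t; t)_m` over the multiplicities `m` of the elements of a multiset. -/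
noncomputable def multiplicityPoch (s : Multiset ℕ) : K :=
  ∏ a ∈ s.toFinset, qPoch t t (s.count a)

lemma qPoch_succ (n : ℕ) : qPoch t t (n + 1) = qPoch t t n * (1 - t ^ (n + 1)) := by
  rw [qPoch, Finset.prod_range_succ, ← pow_succ']
  rfl

lemma qPoch_ne_zero {t : K} (ht : ∀ n : ℕ, 0 < n → t ^ n ≠ 1) (n : ℕ) : qPoch t t n ≠ 0 :=
  Finset.prod_ne_zero_iff.2 fun j _ h => ht (j + 1) (Nat.succ_pos j)
    (by rw [pow_succ']; exact (sub_eq_zero.1 h).symm)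

/-- The value `0` is treated like any other: for a padded partition, `b` includes the Pochhammer
factor of its zeros. -/
lemma hallLittlewoodB_eq {k : ℕ} (l : Fin k → ℕ) :
    hallLittlewoodB t l = multiplicityPoch t (Finset.univ.val.map l) := by
  rw [hallLittlewoodB, multiplicityPoch]
  refine Finset.prod_congr ?_ fun a _ => ?_
  · ext; simp
  · congr 1
    rw [Multiset.count_map, Finset.card_def, Finset.filter_val]
    congr 1
    exact Multiset.filter_congr fun _ _ => eq_comm

lemma multiplicityPoch_erase {s : Multiset ℕ} {a : ℕ} (ha : a ∈ s) :
    multiplicityPoch t s = multiplicityPoch t (s.erase a) * (1 - t ^ s.count a) := by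
  have hsub : (s.erase a).toFinset ⊆ s.toFinset := fun x hx => by
    rw [Multiset.mem_toFinset] at *
    exact Multiset.mem_of_mem_erase hx
  have h1 : multiplicityPoch t (s.erase a) =
      ∏ b ∈ s.toFinset, qPoch t t ((s.erase a).count b) := by
    refine Finset.prod_subset hsub fun x _ hx => ?_
    rw [Multiset.mem_toFinset] at hx
    rw [Multiset.count_eq_zero_of_notMem hx]
    simp [qPoch]
  have ha' : a ∈ s.toFinset := Multiset.mem_toFinset.2 ha
  rw [h1, multiplicityPoch, ← Finset.mul_prod_erase _ _ ha', ← Finset.mul_prod_erase _ _ ha',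
    Multiset.count_erase_self]
  have h2 : ∏ x ∈ s.toFinset.erase a, qPoch t t ((s.erase a).count x) =
      ∏ x ∈ s.toFinset.erase a, qPoch t t (s.count x) :=
    Finset.prod_congr rfl fun x hx => by
      rw [Multiset.count_erase_of_ne (Finset.ne_of_mem_erase hx)]
  obtain ⟨n, hn⟩ : ∃ n, s.count a = n + 1 :=
    ⟨s.count a - 1, by have := Multiset.count_pos.2 ha; omega⟩
  rw [h2, hn, qPoch_succ]
  simp only [Nat.add_sub_cancel]
  ring

lemma ascentCount_cons {k : ℕ} (a : ℕ) (α : Fin k → ℕ) :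
    ascentCount (Fin.cons a α : Fin (k + 1) → ℕ) =
      (Multiset.filter (a < ·) (Finset.univ.val.map α)).card + ascentCount α := by
  rw [ascentCount, Fin.sum_univ_succ]
  congr 1
  · rw [Fin.sum_univ_succ]
    rw [Multiset.filter_map, Multiset.card_map, Finset.sum_boole]
    simp [Finset.card_def, Finset.filter_val]
  · refine Finset.sum_congr rfl fun i _ => ?_
    rw [Fin.sum_univ_succ]
    simp

/-- With `N a` the number of elements `≥ a`, the summand is `t ^ N (a+1) - t ^ N a`, and the sum
telescopes. -/
lemma sum_pow_card_filter_mul (s : Multiset ℕ) :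
    ∑ a ∈ s.toFinset, t ^ (s.filter (a < ·)).card * (1 - t ^ s.count a) = 1 - t ^ s.card := by
  -- both sides are unchanged when the largest element is split off
  have key : ∀ n : ℕ, ∑ a ∈ Finset.range n, t ^ (s.filter (a < ·)).card * (1 - t ^ s.count a) =
      t ^ (s.filter (n ≤ ·)).card - t ^ s.card := by
    intro n
    induction n with
    | zero => simp
    | succ n ih =>
      have h : (s.filter (n ≤ ·)).card = (s.filter (n < ·)).card + s.count n := by
        clear ih
        induction s using Multiset.induction_on with
        | empty => simp
        | cons b s ihs =>
          simp only [Multiset.filter_cons, Multiset.count_cons]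
          split_ifs <;> simp <;> omega
      rw [Finset.sum_range_succ, ih, h, pow_add]
      have h2 : s.filter (n + 1 ≤ ·) = s.filter (n < ·) := rfl
      rw [h2]
      ring
  obtain ⟨n, hn⟩ : ∃ n : ℕ, ∀ a ∈ s, a < n :=
    ⟨s.toFinset.sup id + 1, fun a ha => Nat.lt_succ_of_le
      (Finset.le_sup (f := id) (Multiset.mem_toFinset.2 ha))⟩
  have h1 := key n
  have h2 : s.filter (n ≤ ·) = 0 := Multiset.filter_eq_nil.2 fun a ha => not_le.2 (hn a ha)
  rw [h2, Multiset.card_zero, pow_zero] at h1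
  rw [← h1]
  refine Finset.sum_subset (fun a ha => Finset.mem_range.2 (hn a (Multiset.mem_toFinset.1 ha)))
    fun a _ ha => ?_
  rw [Multiset.count_eq_zero_of_notMem (fun h => ha (Multiset.mem_toFinset.2 h))]
  simp

/-- The rearrangements of a multiset of `k` elements. -/
noncomputable def rearrangements (k : ℕ) (s : Multiset ℕ) : Finset (Fin k → ℕ) :=
  (Fintype.piFinset fun _ => s.toFinset).filter fun α => Finset.univ.val.map α = s

lemma mem_rearrangements {k : ℕ} {s : Multiset ℕ} {α : Fin k → ℕ} :
    α ∈ rearrangements k s ↔ Finset.univ.val.map α = s := by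
  rw [rearrangements, Finset.mem_filter, Fintype.mem_piFinset, and_iff_right_iff_imp]
  rintro rfl i
  simp

lemma map_cons_univ {k : ℕ} (a : ℕ) (α : Fin k → ℕ) :
    Finset.univ.val.map (Fin.cons a α : Fin (k + 1) → ℕ) = a ::ₘ Finset.univ.val.map α := by
  rw [Fin.univ_succ]
  simp

/-- The generating function of the rearrangements of a multiset by the number of ascents is a
`t`-multinomial coefficient. -/
lemma sum_pow_ascentCount {t : K} (ht : ∀ n : ℕ, 0 < n → t ^ n ≠ 1) (k : ℕ) (s : Multiset ℕ)
    (hs : s.card = k) : ∑ α ∈ rearrangements k s, t ^ ascentCount α =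
      qPoch t t k / multiplicityPoch t s := by
  have hpos (s : Multiset ℕ) : multiplicityPoch t s ≠ 0 :=
    Finset.prod_ne_zero_iff.2 fun _ _ => qPoch_ne_zero ht _
  induction k generalizing s with
  | zero =>
    obtain rfl := Multiset.card_eq_zero.1 hs
    have : rearrangements 0 0 = Finset.univ :=
      Finset.eq_univ_iff_forall.2 fun α => mem_rearrangements.2 (by simp)
    rw [this]
    simp [qPoch, multiplicityPoch, ascentCount]
  | succ k ih =>
    -- Condition on the first entry `a`: it creates one ascent for each element of `s` exceeding
    -- `a`.
    have h1 : ∑ α ∈ rearrangements (k + 1) s, t ^ ascentCount α =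
        ∑ a ∈ s.toFinset, ∑ α ∈ rearrangements k (s.erase a),
          t ^ ascentCount (Fin.cons a α : Fin (k + 1) → ℕ) := by
      rw [Finset.sum_sigma']
      symm
      refine Finset.sum_bij' (fun x _ => (Fin.cons x.1 x.2 : Fin (k + 1) → ℕ))
        (fun α _ => ⟨α 0, Fin.tail α⟩) ?_ ?_ ?_ ?_ ?_
      · rintro ⟨a, α⟩ h
        simp only [Finset.mem_sigma, mem_rearrangements, Multiset.mem_toFinset] at h ⊢
        rw [map_cons_univ, h.2, Multiset.cons_erase h.1]
      · intro α h
        simp only [Finset.mem_sigma, mem_rearrangements, Multiset.mem_toFinset] at h ⊢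
        have h2 := map_cons_univ (α 0) (Fin.tail α)
        rw [Fin.cons_self_tail, h] at h2
        rw [h2]
        simp
      · rintro ⟨a, α⟩ _
        simp
      · intro α _
        simp
      · intro _ _
        rfl
    have h2 : ∀ a ∈ s.toFinset, ∑ α ∈ rearrangements k (s.erase a),
        t ^ ascentCount (Fin.cons a α : Fin (k + 1) → ℕ) =
        qPoch t t k / multiplicityPoch t s *
          (t ^ (s.filter (a < ·)).card * (1 - t ^ s.count a)) := by
      intro a ha
      rw [Multiset.mem_toFinset] at ha
      have h3 : ∀ α ∈ rearrangements k (s.erase a),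
          t ^ ascentCount (Fin.cons a α : Fin (k + 1) → ℕ) =
            t ^ (s.filter (a < ·)).card * t ^ ascentCount α := by
        intro α hα
        rw [ascentCount_cons, mem_rearrangements.1 hα, pow_add]
        congr 3
        conv_rhs => rw [← Multiset.cons_erase ha, Multiset.filter_cons_of_neg _ (lt_irrefl a)]
      rw [Finset.sum_congr rfl h3, ← Finset.mul_sum, ih _ (by
        rw [Multiset.card_erase_of_mem ha, hs]; rfl), multiplicityPoch_erase t ha]
      have h4 := hpos s
      rw [multiplicityPoch_erase t ha] at h4
      have h5 := hpos (s.erase a)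
      have h6 := right_ne_zero_of_mul h4
      field_simp
    rw [h1, Finset.sum_congr rfl h2, ← Finset.mul_sum, sum_pow_card_filter_mul, hs, qPoch_succ]
    ring

end Multinomial

/-! ### Symmetric matrices and triangular factorizations. -/

section Triangular

open Matrix

/-- The matrix `Y = C (Xᵀ)⁻¹` is upper triangular, and also equals `X⁻¹ (X C) (Xᵀ)⁻¹`, which is
symmetric; so it is diagonal, with the diagonal of `C` because `X` has unit diagonal. -/
lemma mul_eq_mul_diagonal_mul_transpose {K I : Type*} [Field K] [Fintype I] [DecidableEq I]
    (N : I → ℕ) (X C : Matrix I I K) (hX : ∀ i, X i i = 1)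
    (hX' : ∀ i j, X i j ≠ 0 → i = j ∨ N j < N i) (hC : ∀ i j, C i j ≠ 0 → i = j ∨ N i < N j)
    (hsymm : (X * C)ᵀ = X * C) : X * C = X * (diagonal fun i => C i i) * Xᵀ := by
  -- Ties of `N` are broken arbitrarily to get a linear order; distinct indices with equal `N` have
  -- zero entries, so triangularity is unaffected.
  let b : I → ℕ ×ₗ Fin (Fintype.card I) := fun i => toLex (N i, Fintype.equivFin I i)
  have hb : Function.Injective b := by
    intro i j h
    have h' : (N i, Fintype.equivFin I i) = (N j, Fintype.equivFin I j) := toLex.injective h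
    exact (Fintype.equivFin I).injective (Prod.ext_iff.1 h').2
  let _ : LinearOrder I := LinearOrder.lift' b hb
  have hlt {i j : I} (h : j < i) : ¬ (i = j ∨ N i < N j) := by
    rintro (rfl | h')
    · exact lt_irrefl _ h
    · have h1 : b j < b i := h
      rw [Prod.Lex.toLex_lt_toLex] at h1
      rcases h1 with h1 | h1
      · exact absurd h1 (not_lt.2 h'.le)
      · exact absurd h1.1 h'.ne'
  have hCt : C.IsUpperTriangular := fun i j h => by
    by_contra hc
    exact hlt h (hC i j hc)
  have hXt : Xᵀ.IsUpperTriangular := fun i j h => by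
    by_contra hc
    rcases hX' j i hc with h1 | h1
    · exact hlt h (Or.inl h1.symm)
    · exact hlt h (Or.inr h1)
  have hdet : Xᵀ.det = 1 := by
    rw [det_of_isUpperTriangular hXt]
    exact Finset.prod_eq_one fun i _ => hX i
  have hu : IsUnit Xᵀ.det := by rw [hdet]; exact isUnit_one
  have hu' : IsUnit X.det := by rwa [det_transpose] at hu
  let _ : Invertible Xᵀ := invertibleOfIsUnitDet _ hu
  set Y := C * (Xᵀ)⁻¹ with hY
  have hYt : Y.IsUpperTriangular := hCt.mul (blockTriangular_inv_of_blockTriangular hXt)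
  have hCY : C = Y * Xᵀ := by rw [hY, nonsing_inv_mul_cancel_right _ _ hu]
  have hYs : Yᵀ = Y := by
    have h1 : Y = X⁻¹ * (X * C) * (Xᵀ)⁻¹ := by rw [nonsing_inv_mul_cancel_left _ _ hu']
    rw [h1, transpose_mul, transpose_mul, hsymm, transpose_nonsing_inv, transpose_nonsing_inv,
      transpose_transpose, ← mul_assoc]
  have hYd (i j : I) (h : i ≠ j) : Y i j = 0 := by
    rcases lt_or_gt_of_ne h with h | h
    · rw [← hYs]; exact hYt h
    · exact hYt h
  have hYdiag : Y = diagonal fun i => C i i := by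
    ext i j
    by_cases h : i = j
    · subst h
      rw [diagonal_apply_eq]
      conv_rhs => rw [hCY]
      rw [mul_apply, Finset.sum_eq_single i, transpose_apply, hX, mul_one]
      · intro l _ hl
        rw [hYd i l hl.symm, zero_mul]
      · simp
    · rw [diagonal_apply_ne _ h, hYd i j h]
  rw [mul_assoc, ← hYdiag, ← hCY]

end Triangular

/-! ### Diagonalization of the form defined by `F` on symmetric arrays. -/

section Diagonalization

variable {K : Type*} [Field K] {k : ℕ}

lemma sum_rearrangements_comp {M : Type*} [AddCommMonoid M] (s : Multiset ℕ)
    (σ : Equiv.Perm (Fin k)) (f : (Fin k → ℕ) → M) :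
    ∑ α ∈ rearrangements k s, f (α ∘ σ) = ∑ α ∈ rearrangements k s, f α := by
  have hmem (σ : Equiv.Perm (Fin k)) {α : Fin k → ℕ} (h : α ∈ rearrangements k s) :
      α ∘ σ ∈ rearrangements k s := by
    rw [mem_rearrangements] at *
    rw [← h, ← Multiset.map_map]
    congr 1
    exact Multiset.map_univ_val_equiv σ
  exact Finset.sum_bij' (fun α _ => α ∘ σ) (fun α _ => α ∘ σ.symm) (fun α h => hmem σ h)
    (fun α h => hmem σ.symm h) (fun α _ => by funext; simp) (fun α _ => by funext; simp)
    (fun _ _ => rfl)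

lemma eq_of_antitone_of_map_eq {α β : Fin k → ℕ} (hα : Antitone α) (hβ : Antitone β)
    (h : Finset.univ.val.map α = Finset.univ.val.map β) : α = β := by
  rw [Fin.univ_val_map, Fin.univ_val_map, Multiset.coe_eq_coe] at h
  exact List.ofFn_injective (h.eq_of_sortedGE hα.sortedGE_ofFn hβ.sortedGE_ofFn)

lemma map_sortDesc (α : Fin k → ℕ) :
    Finset.univ.val.map (sortDesc α) = Finset.univ.val.map α := by
  obtain ⟨σ, hσ⟩ := exists_sortDesc_eq_comp α
  rw [hσ, ← Multiset.map_map]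
  congr 1
  exact Multiset.map_univ_val_equiv σ

lemma mem_rearrangements_iff_sortDesc {μ α : Fin k → ℕ} (hμ : Antitone μ) :
    α ∈ rearrangements k (Finset.univ.val.map μ) ↔ sortDesc α = μ := by
  rw [mem_rearrangements, ← map_sortDesc α]
  exact ⟨fun h => eq_of_antitone_of_map_eq (antitone_sortDesc α) hμ h, fun h => by rw [h]⟩

open Classical in
/-- The partitions of `d` with at most `k` parts, padded with zeros. -/
noncomputable def paddedPartitions (k d : ℕ) : Finset (Fin k → ℕ) :=
  (Finset.piAntidiag Finset.univ d).filter Antitone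

lemma mem_paddedPartitions {d : ℕ} {μ : Fin k → ℕ} :
    μ ∈ paddedPartitions k d ↔ Antitone μ ∧ ∑ i, μ i = d := by
  simp [paddedPartitions, and_comm]

lemma sum_piAntidiag_eq {M : Type*} [AddCommMonoid M] (d : ℕ) (f : (Fin k → ℕ) → M) :
    ∑ α ∈ Finset.piAntidiag Finset.univ d, f α = ∑ μ ∈ paddedPartitions k d,
      ∑ α ∈ rearrangements k (Finset.univ.val.map μ), f α := by
  have hmaps : ∀ α ∈ Finset.piAntidiag (Finset.univ : Finset (Fin k)) d,
      sortDesc α ∈ paddedPartitions k d := by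
    intro α hα
    rw [mem_paddedPartitions]
    refine ⟨antitone_sortDesc α, (sum_comp_sortDesc α id).trans ?_⟩
    exact (Finset.mem_piAntidiag.1 hα).1
  rw [← Finset.sum_fiberwise_of_maps_to hmaps]
  refine Finset.sum_congr rfl fun μ hμ => Finset.sum_congr ?_ fun _ _ => rfl
  rw [mem_paddedPartitions] at hμ
  ext α
  rw [mem_rearrangements_iff_sortDesc hμ.1, Finset.mem_filter, and_iff_right_iff_imp]
  rintro rfl
  rw [Finset.mem_piAntidiag]
  exact ⟨(sum_comp_sortDesc α id).symm.trans hμ.2, fun i _ => Finset.mem_univ i⟩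

variable (t : K)

/-- The coefficient at `z^β` of `m_λ(z) F(z)`, where `m_λ` is the sum of the monomials `z^α` over the
rearrangements `α` of `λ`. -/
noncomputable def monomialCoeffF (lam β : Fin k → ℕ) : K :=
  ∑ α ∈ rearrangements k (Finset.univ.val.map lam), coeffF t fun i => (β i : ℤ) - α i

/-- Multiplication by the symmetric `m_λ` preserves the antisymmetry of `(z_i - t z_j) F`; this is
the resulting relation at exponents `(a+1, b+1)` in positions `i, j`. -/
lemma monomialCoeffF_update₂ (lam γ : Fin k → ℕ) {i j : Fin k} (hij : (j : ℕ) = i + 1) (a b : ℕ) :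
    monomialCoeffF t lam (update₂ γ i j a (b + 1)) +
        monomialCoeffF t lam (update₂ γ i j b (a + 1)) =
      t * (monomialCoeffF t lam (update₂ γ i j (a + 1) b) +
        monomialCoeffF t lam (update₂ γ i j (b + 1) a)) := by
  have hne : i ≠ j := by rintro rfl; omega
  let c (a b : ℕ) (α : Fin k → ℕ) : K := coeffF t fun l => (update₂ γ i j a b l : ℤ) - α l
  have key (α : Fin k → ℕ) : c a (b + 1) α - t * c (a + 1) b α =
      -(c b (a + 1) (α ∘ Equiv.swap i j) - t * c (b + 1) a (α ∘ Equiv.swap i j)) := by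
    have h := coeffF_antisymm t hij fun l => (update₂ γ i j (a + 1) (b + 1) l : ℤ) - α l
    have e1 (x y : ℕ) : c x (y + 1) α =
        coeffF t ((fun l => (update₂ γ i j (x + 1) (y + 1) l : ℤ) - α l) - Pi.single i 1) := by
      refine congrArg (coeffF t) (funext fun l => ?_)
      simp only [update₂, Function.update_apply, Pi.sub_apply, Pi.single_apply]
      split_ifs <;> (simp_all; try ring)
    have e2 (x y : ℕ) : c (x + 1) y α =
        coeffF t ((fun l => (update₂ γ i j (x + 1) (y + 1) l : ℤ) - α l) - Pi.single j 1) := by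
      refine congrArg (coeffF t) (funext fun l => ?_)
      simp only [update₂, Function.update_apply, Pi.sub_apply, Pi.single_apply]
      split_ifs <;> (simp_all; try ring)
    have e3 : c b (a + 1) (α ∘ Equiv.swap i j) =
        coeffF t ((fun l => (update₂ γ i j (a + 1) (b + 1) l : ℤ) - α l) ∘ Equiv.swap i j -
          Pi.single i 1) := by
      refine congrArg (coeffF t) (funext fun l => ?_)
      simp only [update₂, Function.update_apply, Pi.sub_apply, Pi.single_apply, Function.comp,
        Equiv.swap_apply_def]
      split_ifs <;> (simp_all; try ring)
    have e4 : c (b + 1) a (α ∘ Equiv.swap i j) =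
        coeffF t ((fun l => (update₂ γ i j (a + 1) (b + 1) l : ℤ) - α l) ∘ Equiv.swap i j -
          Pi.single j 1) := by
      refine congrArg (coeffF t) (funext fun l => ?_)
      simp only [update₂, Function.update_apply, Pi.sub_apply, Pi.single_apply, Function.comp,
        Equiv.swap_apply_def]
      split_ifs <;> (simp_all; try ring)
    rw [e1, e2, e3, e4]
    exact h
  have hsum := Finset.sum_congr (rfl : rearrangements k (Finset.univ.val.map lam) = _)
    fun α _ => key α
  rw [Finset.sum_neg_distrib, Finset.sum_sub_distrib, ← Finset.mul_sum,
    sum_rearrangements_comp (Finset.univ.val.map lam) (Equiv.swap i j)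
      (fun α => c b (a + 1) α - t * c (b + 1) a α), Finset.sum_sub_distrib, ← Finset.mul_sum] at hsum
  simp only [monomialCoeffF]
  linear_combination hsum

/-- Orbits are stable under reversal of positions, so the invariance of `coeffF` under reversal and
negation exchanges the two orbits. -/
lemma sum_monomialCoeffF_comm (lam lam' : Fin k → ℕ) :
    ∑ β ∈ rearrangements k (Finset.univ.val.map lam'), monomialCoeffF t lam β =
      ∑ β ∈ rearrangements k (Finset.univ.val.map lam), monomialCoeffF t lam' β := by
  simp only [monomialCoeffF]
  rw [Finset.sum_comm, ← sum_rearrangements_comp _ Fin.revPerm]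
  refine Finset.sum_congr rfl fun α _ => ?_
  rw [← sum_rearrangements_comp _ Fin.revPerm]
  refine Finset.sum_congr rfl fun β _ => ?_
  rw [← coeffF_neg_rev]
  congr 1
  funext l
  simp

lemma monomialCoeffF_ne_zero {lam μ : Fin k → ℕ} (hlam : Antitone lam) (hμ : Antitone μ)
    (h : monomialCoeffF t lam μ ≠ 0) : lam = μ ∨ ∑ i, μ i ^ 2 < ∑ i, lam i ^ 2 := by
  obtain ⟨α, hα, h⟩ := Finset.exists_ne_zero_of_sum_ne_zero h
  rw [mem_rearrangements_iff_sortDesc hlam] at hα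
  rcases eq_or_lt_of_coeffF_ne_zero t hμ h with h | h
  · left
    rw [← hα, h, sortDesc_of_antitone hμ]
  · right
    rwa [← hα, sum_comp_sortDesc α fun x => x ^ 2]

lemma monomialCoeffF_self {μ : Fin k → ℕ} (hμ : Antitone μ) : monomialCoeffF t μ μ = 1 := by
  rw [monomialCoeffF, Finset.sum_eq_single μ]
  · rw [← coeffF_zero t (k := k)]
    congr 1
    funext i
    simp
  · intro α hα hne
    by_contra hc
    rw [mem_rearrangements_iff_sortDesc hμ] at hα
    rcases eq_or_lt_of_coeffF_ne_zero t hμ hc with h | h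
    · exact hne h
    · rw [← sum_comp_sortDesc α fun x => x ^ 2, hα] at h
      exact lt_irrefl _ h
  · intro h
    exact absurd (mem_rearrangements.2 rfl) h

variable {t}

/-- The coefficients of the expansion of the orbit sums over all `β` through the values at
partitions. -/
lemma exists_straightening_coeff [CharZero K] (ht : ∀ n : ℕ, 0 < n → t ^ n ≠ 1) {d : ℕ}
    (μ : paddedPartitions k d) : ∃ C : paddedPartitions k d → K,
      C μ = qPoch t t k / hallLittlewoodB t μ.1 ∧
      (∀ ν, C ν ≠ 0 → ν = μ ∨ ∑ i, ν.1 i ^ 2 < ∑ i, μ.1 i ^ 2) ∧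
      ∀ lam : paddedPartitions k d,
        ∑ β ∈ rearrangements k (Finset.univ.val.map μ.1), monomialCoeffF t lam.1 β =
          ∑ ν, monomialCoeffF t lam.1 ν.1 * C ν := by
  classical
  -- Straightening takes place in the space of functions of `lam`, so that one family of
  -- coefficients `C` serves all `lam` at once.
  let X : (Fin k → ℕ) → paddedPartitions k d → K := fun β lam => monomialCoeffF t lam.1 β
  have hX : IsStraightening t X := fun γ i j hij a b => by
    funext lam
    exact monomialCoeffF_update₂ t lam.1 γ hij a b
  have hμ := mem_paddedPartitions.1 μ.2
  let Y : paddedPartitions k d → paddedPartitions k d → K := fun ν => X ν.1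
  let S : Set (paddedPartitions k d) := {ν | ∑ i, ν.1 i ^ 2 < ∑ i, μ.1 i ^ 2}
  have h1 : ∑ β ∈ rearrangements k (Finset.univ.val.map μ.1),
      (X β - t ^ ascentCount β • X μ.1) ∈ Submodule.span K (Y '' S) := by
    refine sum_mem fun β hβ => ?_
    rw [mem_rearrangements_iff_sortDesc hμ.1] at hβ
    have h := hX.sub_mem_span β
    rw [hβ] at h
    refine Submodule.span_mono ?_ h
    rintro _ ⟨ν, ⟨h2, h3, h4⟩, rfl⟩
    have h5 : ∑ i, β i = d := by
      rw [← hμ.2, ← hβ]; exact (sum_comp_sortDesc β id).symm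
    have h6 : ∑ i, β i ^ 2 = ∑ i, μ.1 i ^ 2 := by
      rw [← hβ]; exact (sum_comp_sortDesc β fun x => x ^ 2).symm
    exact ⟨⟨ν, mem_paddedPartitions.2 ⟨h2, h3.trans h5⟩⟩, h4.trans_eq h6, rfl⟩
  rw [Finset.sum_sub_distrib, ← Finset.sum_smul, sum_pow_ascentCount ht k _ (by simp),
    ← hallLittlewoodB_eq, Finsupp.mem_span_image_iff_linearCombination] at h1
  obtain ⟨c, hc, h1⟩ := h1
  rw [Finsupp.mem_supported] at hc
  -- The correction terms have strictly smaller sum of squares, so the diagonal coefficient is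
  -- exactly the multinomial one.
  have hcμ : c μ = 0 := by
    by_contra h
    have h' : ∑ i, μ.1 i ^ 2 < ∑ i, μ.1 i ^ 2 := hc (Finsupp.mem_support_iff.2 h)
    exact lt_irrefl _ h'
  refine ⟨fun ν => c ν + if ν = μ then qPoch t t k / hallLittlewoodB t μ.1 else 0, ?_, ?_, ?_⟩
  · simp [hcμ]
  · intro ν hν
    by_cases h : ν = μ
    · exact Or.inl h
    · simp only [if_neg h, add_zero] at hν
      exact Or.inr (hc (Finsupp.mem_support_iff.2 hν))
  · intro lam
    have h2 := congrFun (eq_add_of_sub_eq h1.symm) lam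
    rw [Finset.sum_apply] at h2
    refine h2.trans ?_
    rw [Finsupp.linearCombination_apply, Finsupp.sum_fintype c (fun i a => a • Y i)
      fun _ => zero_smul _ _]
    simp only [mul_add, Finset.sum_add_distrib, Pi.add_apply, Finset.sum_apply, Pi.smul_apply,
      smul_eq_mul, mul_ite, mul_zero, Finset.sum_ite_eq', Finset.mem_univ, if_true]
    congr 1
    · exact Finset.sum_congr rfl fun ν _ => mul_comm _ _
    · exact mul_comm _ _

/-- This is the entry at `(lam, lam')` of the factorization `G = X D Xᵀ`. -/
lemma sum_monomialCoeffF_eq [CharZero K] (ht : ∀ n : ℕ, 0 < n → t ^ n ≠ 1) {d : ℕ}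
    {lam lam' : Fin k → ℕ} (h : lam ∈ paddedPartitions k d) (h' : lam' ∈ paddedPartitions k d) :
    ∑ β ∈ rearrangements k (Finset.univ.val.map lam'), monomialCoeffF t lam β =
      ∑ μ ∈ paddedPartitions k d, qPoch t t k / hallLittlewoodB t μ *
        (monomialCoeffF t lam μ * monomialCoeffF t lam' μ) := by
  classical
  choose C hC1 hC2 hC3 using fun μ : paddedPartitions k d => exists_straightening_coeff ht μ
  let X : Matrix (paddedPartitions k d) (paddedPartitions k d) K :=
    fun lam μ => monomialCoeffF t lam.1 μ.1
  let D : Matrix (paddedPartitions k d) (paddedPartitions k d) K := fun ν μ => C μ ν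
  have hXD (lam μ : paddedPartitions k d) : (X * D) lam μ =
      ∑ β ∈ rearrangements k (Finset.univ.val.map μ.1), monomialCoeffF t lam.1 β :=
    (hC3 μ lam).symm
  have hmono (μ : paddedPartitions k d) : Antitone μ.1 := (mem_paddedPartitions.1 μ.2).1
  have hmain := mul_eq_mul_diagonal_mul_transpose (fun μ => ∑ i, μ.1 i ^ 2) X D
    (fun μ => monomialCoeffF_self t (hmono μ))
    (fun lam μ h => by
      rcases monomialCoeffF_ne_zero t (hmono lam) (hmono μ) h with h | h
      · exact Or.inl (Subtype.ext h)
      · exact Or.inr h)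
    (fun ν μ h => hC2 μ ν h)
    (by
      ext lam μ
      rw [Matrix.transpose_apply, hXD, hXD, sum_monomialCoeffF_comm])
  have h1 := congrFun (congrFun hmain ⟨lam, h⟩) ⟨lam', h'⟩
  rw [hXD] at h1
  rw [h1, Matrix.mul_apply, ← Finset.sum_coe_sort (paddedPartitions k d)]
  refine Finset.sum_congr rfl fun μ _ => ?_
  rw [Matrix.mul_diagonal, Matrix.transpose_apply]
  change X _ _ * C μ μ * X _ _ = _
  rw [hC1]
  ring

/-- On arrays symmetric in each index, the bilinear form given by the coefficients of `F` is
diagonalized by the functionals of taking coefficients of `(·) F` at partitions. -/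
lemma sum_coeffF_smul_eq [CharZero K] (ht : ∀ n : ℕ, 0 < n → t ^ n ≠ 1) {M : Type*}
    [AddCommGroup M] [Module K M] (y : (Fin k → ℕ) → (Fin k → ℕ) → M)
    (hy : ∀ m n (σ : Equiv.Perm (Fin k)), y (m ∘ σ) n = y m n)
    (hy' : ∀ m n (σ : Equiv.Perm (Fin k)), y m (n ∘ σ) = y m n) (d : ℕ) :
    ∑ n ∈ Finset.piAntidiag Finset.univ d, ∑ m ∈ Finset.piAntidiag Finset.univ d,
        coeffF t (fun i => (n i : ℤ) - m i) • y m n =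
      ∑ μ ∈ paddedPartitions k d, (qPoch t t k / hallLittlewoodB t μ) •
        ∑ n ∈ Finset.piAntidiag Finset.univ d, ∑ m ∈ Finset.piAntidiag Finset.univ d,
          (coeffF t (fun i => (μ i : ℤ) - m i) * coeffF t (fun i => (μ i : ℤ) - n i)) • y m n := by
  have hyy {lam lam' m n : Fin k → ℕ} (hm : m ∈ rearrangements k (Finset.univ.val.map lam))
      (hn : n ∈ rearrangements k (Finset.univ.val.map lam')) (h : lam ∈ paddedPartitions k d)
      (h' : lam' ∈ paddedPartitions k d) : y m n = y lam lam' := by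
    rw [mem_rearrangements_iff_sortDesc (mem_paddedPartitions.1 h).1] at hm
    rw [mem_rearrangements_iff_sortDesc (mem_paddedPartitions.1 h').1] at hn
    obtain ⟨σ, hσ⟩ := exists_sortDesc_eq_comp m
    obtain ⟨τ, hτ⟩ := exists_sortDesc_eq_comp n
    rw [← hm, ← hn, hσ, hτ, hy, hy']
  -- As `y` is constant on products of orbits, both sides reduce to sums over pairs of partitions,
  -- where only the orbit sums of the scalar coefficients matter.
  have hgroup (f : (Fin k → ℕ) → (Fin k → ℕ) → K) :
      ∑ n ∈ Finset.piAntidiag Finset.univ d, ∑ m ∈ Finset.piAntidiag Finset.univ d, f m n • y m n =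
      ∑ lam' ∈ paddedPartitions k d, ∑ lam ∈ paddedPartitions k d,
        (∑ n ∈ rearrangements k (Finset.univ.val.map lam'),
          ∑ m ∈ rearrangements k (Finset.univ.val.map lam), f m n) • y lam lam' := by
    rw [sum_piAntidiag_eq]
    refine Finset.sum_congr rfl fun lam' h' => ?_
    simp only [sum_piAntidiag_eq]
    rw [Finset.sum_comm]
    refine Finset.sum_congr rfl fun lam h => ?_
    simp only [Finset.sum_smul]
    exact Finset.sum_congr rfl fun n hn => Finset.sum_congr rfl fun m hm => by
      rw [hyy hm hn h h']
  have hprod (μ lam lam' : Fin k → ℕ) : ∑ n ∈ rearrangements k (Finset.univ.val.map lam'),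
      ∑ m ∈ rearrangements k (Finset.univ.val.map lam),
        coeffF t (fun i => (μ i : ℤ) - m i) * coeffF t (fun i => (μ i : ℤ) - n i) =
      monomialCoeffF t lam μ * monomialCoeffF t lam' μ := by
    simp only [← Finset.sum_mul]
    rw [← Finset.mul_sum]
    rfl
  rw [hgroup fun m n => coeffF t fun i => (n i : ℤ) - m i]
  simp only [fun μ : Fin k → ℕ => hgroup fun m n =>
    coeffF t (fun i => (μ i : ℤ) - m i) * coeffF t (fun i => (μ i : ℤ) - n i), hprod]
  simp only [Finset.smul_sum, smul_smul]
  rw [Finset.sum_comm]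
  conv_rhs => rw [Finset.sum_comm]; enter [2, lam]; rw [Finset.sum_comm]
  rw [Finset.sum_comm]
  refine Finset.sum_congr rfl fun lam' h' => Finset.sum_congr rfl fun lam h => ?_
  rw [← Finset.sum_smul, ← sum_monomialCoeffF_eq ht h h']
  rfl

end Diagonalization

/-! ### Degrees of `Q_n` and `Q_λ`; padding by zeros. -/

section Order

variable {K : Type*} [Field K]

/-- The symmetric functions all of whose monomials have degree at least `n`. -/
def orderGE (n : ℕ) : Submodule K (SymFun K) where
  carrier := {f | ∀ m : ℕ →₀ ℕ, m.degree < n → MvPowerSeries.coeff m (f : MvPowerSeries ℕ K) = 0}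
  add_mem' := fun {f g} hf hg m hm => by
    rw [Subalgebra.coe_add, map_add, hf m hm, hg m hm, add_zero]
  zero_mem' := fun m _ => by simp
  smul_mem' := fun c f hf m hm => by
    rw [Subalgebra.coe_smul, map_smul, hf m hm, smul_zero]

lemma mul_mem_orderGE {a b : ℕ} {f g : SymFun K} (hf : f ∈ orderGE a) (hg : g ∈ orderGE b) :
    f * g ∈ orderGE (a + b) := by
  classical
  intro m hm
  rw [Subalgebra.coe_mul, MvPowerSeries.coeff_mul]
  refine Finset.sum_eq_zero fun p hp => ?_
  rw [Finset.HasAntidiagonal.mem_antidiagonal] at hp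
  have h : p.1.degree + p.2.degree = m.degree := by rw [← hp, map_add]
  by_cases h1 : p.1.degree < a
  · rw [hf _ h1, zero_mul]
  · rw [hg p.2 (by omega), mul_zero]

lemma mem_orderGE_zero (f : SymFun K) : f ∈ orderGE 0 := fun _ h => absurd h (Nat.not_lt_zero _)

lemma prod_mem_orderGE {ι : Type*} (s : Finset ι) (f : ι → SymFun K) (a : ι → ℕ)
    (h : ∀ i ∈ s, f i ∈ orderGE (a i)) : ∏ i ∈ s, f i ∈ orderGE (∑ i ∈ s, a i) := by
  classical
  induction s using Finset.induction_on with
  | empty => exact mem_orderGE_zero _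
  | insert i s hi ih =>
    rw [Finset.prod_insert hi, Finset.sum_insert hi]
    exact mul_mem_orderGE (h i (Finset.mem_insert_self i s))
      (ih fun j hj => h j (Finset.mem_insert_of_mem hj))

lemma elemSym_mem_orderGE (n : ℕ) : elemSym K n ∈ orderGE n := by
  classical
  intro m hm
  have h : MvPowerSeries.coeff m ((elemSym K n : SymFun K) : MvPowerSeries ℕ K) =
    if m.degree = n ∧ ∀ i, m i ≤ 1 then 1 else 0 := coeff_elemSymSeries K n m
  rw [h, if_neg]
  rintro ⟨h, -⟩
  omega

lemma elemSym_zero : elemSym K 0 = 1 := by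
  classical
  refine Subtype.ext (MvPowerSeries.ext fun m => ?_)
  have h1 : MvPowerSeries.coeff m ((elemSym K 0 : SymFun K) : MvPowerSeries ℕ K) =
    if m.degree = 0 ∧ ∀ i, m i ≤ 1 then 1 else 0 := coeff_elemSymSeries K 0 m
  have h2 : MvPowerSeries.coeff m ((1 : SymFun K) : MvPowerSeries ℕ K) =
    if m = 0 then 1 else 0 := MvPowerSeries.coeff_one m
  rw [h1, h2]
  refine if_congr ?_ rfl rfl
  rw [Finsupp.degree_eq_zero_iff]
  constructor
  · exact And.left
  · rintro rfl
    simp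

lemma smul_mem_orderGE {n : ℕ} (c : K) {f : SymFun K} (hf : f ∈ orderGE n) :
    algebraMap K (SymFun K) c * f ∈ orderGE n := by
  rw [← Algebra.smul_def]
  exact Submodule.smul_mem _ _ hf

lemma coeff_rescale_seriesE (c : K) (n : ℕ) :
    PowerSeries.coeff n (PowerSeries.rescale (algebraMap K (SymFun K) c) (seriesE K)) =
      algebraMap K (SymFun K) (c ^ n) * elemSym K n := by
  rw [PowerSeries.coeff_rescale, seriesE, PowerSeries.coeff_mk, map_pow]

/-- The recursion contained in `E(-z) H(z) = 1` expresses `h_n` through products `e_i h_{n-i}` with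
`i > 0`, up to the constant term. -/
lemma coeff_seriesH_mem_orderGE (n : ℕ) : PowerSeries.coeff n (seriesH K) ∈ orderGE n := by
  classical
  induction n using Nat.strong_induction_on with
  | _ n ih =>
  have h := congrArg (PowerSeries.coeff n) (seriesE_mul_seriesH K)
  have h1 : (-1 : SymFun K) = algebraMap K (SymFun K) (-1) := by simp
  rw [h1, PowerSeries.coeff_mul, ← Finset.add_sum_erase _ _
    (Finset.HasAntidiagonal.mem_antidiagonal.2 (Nat.zero_add n) :
      (0, n) ∈ Finset.HasAntidiagonal.antidiagonal n), coeff_rescale_seriesE, elemSym_zero,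
    pow_zero, map_one, one_mul, one_mul] at h
  rw [eq_sub_of_add_eq h]
  refine sub_mem ?_ (sum_mem fun p hp => ?_)
  · rw [PowerSeries.coeff_one]
    split_ifs with hn
    · rw [hn]; exact mem_orderGE_zero _
    · exact zero_mem _
  · obtain ⟨hne, hp⟩ := Finset.mem_erase.1 hp
    have hp := Finset.HasAntidiagonal.mem_antidiagonal.1 hp
    have h2 : p.2 < n := by
      by_contra hc
      exact hne (Prod.ext (by simp; omega) (by simp; omega))
    rw [coeff_rescale_seriesE, ← hp]
    exact mul_mem_orderGE (smul_mem_orderGE _ (elemSym_mem_orderGE _)) (ih _ h2)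

variable (t : K)

lemma oneRowQ_eq (n : ℕ) : oneRowQ t n = ∑ p ∈ Finset.HasAntidiagonal.antidiagonal n,
    algebraMap K (SymFun K) ((-t) ^ p.1) * elemSym K p.1 * PowerSeries.coeff p.2 (seriesH K) := by
  rw [oneRowQ, seriesQ, ← map_neg, PowerSeries.coeff_mul]
  exact Finset.sum_congr rfl fun p _ => by rw [coeff_rescale_seriesE]

lemma oneRowQ_mem_orderGE (n : ℕ) : oneRowQ t n ∈ orderGE n := by
  rw [oneRowQ_eq]
  refine sum_mem fun p hp => ?_
  rw [← Finset.HasAntidiagonal.mem_antidiagonal.1 hp]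
  exact mul_mem_orderGE (smul_mem_orderGE _ (elemSym_mem_orderGE _)) (coeff_seriesH_mem_orderGE _)

lemma oneRowQ_zero : oneRowQ t 0 = 1 := by
  rw [oneRowQ_eq]
  simp [elemSym_zero, seriesH]

lemma hallLittlewoodQ_eq_sum {k : ℕ} (l : Fin k → ℕ) : hallLittlewoodQ t l =
    ∑ m ∈ Finset.piAntidiag Finset.univ (∑ i, l i),
      coeffF t (fun i => (l i : ℤ) - m i) • ∏ i, oneRowQ t (m i) := by
  refine finsum_eq_sum_of_support_subset _ fun m hm => ?_
  have h := sum_eq_zero_of_coeffF_ne_zero t (left_ne_zero_of_smul hm)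
  rw [Finset.sum_sub_distrib, sub_eq_zero] at h
  rw [Finset.mem_coe, Finset.mem_piAntidiag]
  exact ⟨by exact_mod_cast h.symm, fun i _ => Finset.mem_univ i⟩

lemma prod_oneRowQ_mem_orderGE {k : ℕ} (m : Fin k → ℕ) :
    ∏ i, oneRowQ t (m i) ∈ orderGE (∑ i, m i) :=
  prod_mem_orderGE _ _ _ fun i _ => oneRowQ_mem_orderGE t (m i)

lemma hallLittlewoodQ_mem_orderGE {k : ℕ} (l : Fin k → ℕ) :
    hallLittlewoodQ t l ∈ orderGE (∑ i, l i) := by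
  rw [hallLittlewoodQ_eq_sum]
  refine sum_mem fun m hm => Submodule.smul_mem _ _ ?_
  rw [← (Finset.mem_piAntidiag.1 hm).1]
  exact prod_oneRowQ_mem_orderGE t m

/-- The last exponent of `F` is never negative, so a last part `0` forces the last index `m` to be
`0`, where `Q_0 = 1`; the remaining coefficients agree by `coeffF_snoc_zero`. -/
lemma hallLittlewoodQ_snoc_zero {k : ℕ} (l : Fin k → ℕ) :
    hallLittlewoodQ t (Fin.snoc l 0 : Fin (k + 1) → ℕ) = hallLittlewoodQ t l := by
  have hsum (m : Fin k → ℕ) (a : ℕ) : ∑ i, (Fin.snoc m a : Fin (k + 1) → ℕ) i = ∑ i, m i + a := by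
    rw [Fin.sum_univ_castSucc]
    simp
  rw [hallLittlewoodQ_eq_sum, hallLittlewoodQ_eq_sum]
  symm
  refine Finset.sum_of_injOn (fun m => (Fin.snoc m 0 : Fin (k + 1) → ℕ)) ?_ ?_ ?_ ?_
  · intro m _ m' _ h
    exact (Fin.snoc_inj.1 h).1
  · intro m hm
    rw [Finset.mem_coe, Finset.mem_piAntidiag] at hm ⊢
    exact ⟨by rw [hsum, hsum, hm.1], fun i _ => Finset.mem_univ i⟩
  · intro m hm hm'
    rw [Finset.mem_piAntidiag] at hm
    suffices h : coeffF t (fun i => ((Fin.snoc l 0 : Fin (k + 1) → ℕ) i : ℤ) - m i) = 0 by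
      rw [h, zero_smul]
    by_contra hc
    have h := last_nonneg_of_coeffF_ne_zero t hc
    simp only [Fin.snoc_last] at h
    have h0 : m (Fin.last k) = 0 := by omega
    have h1 : (Fin.snoc (Fin.init m) 0 : Fin (k + 1) → ℕ) = m := by
      rw [← h0]; exact Fin.snoc_init_self m
    refine hm' ⟨Fin.init m, ?_, h1⟩
    rw [Finset.mem_coe, Finset.mem_piAntidiag]
    have h2 := hm.1
    rw [← h1, hsum, hsum] at h2
    exact ⟨by simpa using h2, fun i _ => Finset.mem_univ i⟩
  · intro m _
    congr 1
    · rw [← coeffF_snoc_zero]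
      congr 1
      funext i
      refine Fin.lastCases ?_ (fun i => ?_) i <;> simp
    · rw [Fin.prod_univ_castSucc]
      simp [oneRowQ_zero]

end Order

/-! ### Nondegeneracy of the form and conjugate operators. -/

section Adjoint

variable {K : Type*} [Field K] [CharZero K]

lemma isHomogeneous_powerSumBasis (a : ℕ+ →₀ ℕ) :
    ((powerSumBasis K a : SymFun K) : MvPowerSeries ℕ K).IsHomogeneous
      (a.sum fun n k => (n : ℕ) * k) := by
  classical
  have h1 : MvPowerSeries.IsHomogeneous (1 : MvPowerSeries ℕ K) 0 := by
    refine MvPowerSeries.isHomogeneous_iff_eq_homogeneousComponent.2 ?_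
    ext m
    rw [MvPowerSeries.coeff_homogeneousComponent, MvPowerSeries.coeff_one]
    by_cases hm : m = 0 <;> simp [hm]
  have hp (n : ℕ+) : (powerSumSeries K n).IsHomogeneous n := by
    refine MvPowerSeries.isHomogeneous_iff_eq_homogeneousComponent.2 ?_
    ext m
    rw [MvPowerSeries.coeff_homogeneousComponent, coeff_powerSumSeries]
    split_ifs with h2 h3 h3
    · rfl
    · obtain ⟨i, rfl⟩ := h2
      simp at h3
    · rfl
    · rfl
  have hpow (n : ℕ+) (k : ℕ) : (powerSumSeries K n ^ k).IsHomogeneous (n * k) := by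
    induction k with
    | zero => rw [pow_zero]; exact h1
    | succ k ih =>
      rw [pow_succ, Nat.mul_succ]
      exact ih.mul (hp n)
  have hprod (s : Finset ℕ+) : ((∏ n ∈ s, powerSum K n ^ a n : SymFun K) :
      MvPowerSeries ℕ K).IsHomogeneous (∑ n ∈ s, (n : ℕ) * a n) := by
    induction s using Finset.induction_on with
    | empty => exact h1
    | insert i s hi ih =>
      rw [Finset.prod_insert hi, Finset.sum_insert hi]
      have h := @hpow i (a i)
      change (powerSumSeries K i ^ a i * ((∏ n ∈ s, powerSum K n ^ a n : SymFun K) :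
        MvPowerSeries ℕ K)).IsHomogeneous _
      exact h.mul ih
  rw [powerSumBasis_apply]
  exact @hprod a.support

/-- The terms of weight `wt a` in the power sum expansion add up to the homogeneous component of `f`
of that degree, which vanishes; linear independence then kills each coefficient. -/
lemma repr_eq_zero_of_mem_orderGE {n : ℕ} {f : SymFun K} (hf : f ∈ orderGE n) {a : ℕ+ →₀ ℕ}
    (ha : (a.sum fun n k => (n : ℕ) * k) < n) : (powerSumBasis K).repr f a = 0 := by
  classical
  let wt : (ℕ+ →₀ ℕ) → ℕ := fun a => a.sum fun n k => (n : ℕ) * k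
  let c := (powerSumBasis K).repr f
  have h1 : (powerSumBasis K).repr.symm (c.filter fun b => wt b = wt a) = 0 := by
    refine Subtype.ext (MvPowerSeries.ext fun m => ?_)
    have hcoe (c : (ℕ+ →₀ ℕ) →₀ K) : MvPowerSeries.coeff m
        (((powerSumBasis K).repr.symm c : SymFun K) : MvPowerSeries ℕ K) =
        c.sum fun b r => r * MvPowerSeries.coeff m (powerSumBasis K b : MvPowerSeries ℕ K) := by
      rw [Module.Basis.repr_symm_apply, Finsupp.linearCombination_apply, Finsupp.sum,
        AddSubmonoidClass.coe_finsetSum, map_sum]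
      rfl
    rw [hcoe, Finsupp.sum_filter_index, ZeroMemClass.coe_zero, map_zero]
    by_cases hm : m.degree = wt a
    · have h2 := hf m (by rw [hm]; exact ha)
      rw [← (powerSumBasis K).repr.symm_apply_apply f, hcoe] at h2
      rw [← h2, Finsupp.sum, Finsupp.support_filter, Finset.sum_filter]
      refine Finset.sum_congr rfl fun b _ => ?_
      split_ifs with hb
      · rfl
      · have hh := @isHomogeneous_powerSumBasis K _ _ b
        rw [hh.coeff_eq_zero, mul_zero]
        rw [hm]
        exact Ne.symm hb
    · refine Finset.sum_eq_zero fun b hb => ?_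
      have hh := @isHomogeneous_powerSumBasis K _ _ b
      rw [hh.coeff_eq_zero, mul_zero]
      have hb' : wt b = wt a := (Finset.mem_filter.1 hb).2
      intro h
      exact hm (h.trans hb')
  have h2 : (c.filter fun b => wt b = wt a) = 0 := by
    rwa [LinearEquiv.map_eq_zero_iff] at h1
  have h3 := DFunLike.congr_fun h2 a
  rwa [Finsupp.filter_apply_pos (fun b => wt b = wt a) c rfl] at h3

variable {q t : K}

lemma powerSumNorm_ne_zero (hq : ∀ n : ℕ, 0 < n → q ^ n ≠ 1) (ht : ∀ n : ℕ, 0 < n → t ^ n ≠ 1)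
    (a : ℕ+ →₀ ℕ) : powerSumNorm q t a ≠ 0 := by
  refine Finset.prod_ne_zero_iff.2 fun n _ => ?_
  have h1 : (n : K) ≠ 0 := by exact_mod_cast n.pos.ne'
  have h2 : 1 - q ^ (n : ℕ) ≠ 0 := sub_ne_zero.2 (hq n n.pos).symm
  have h3 : 1 - t ^ (n : ℕ) ≠ 0 := sub_ne_zero.2 (ht n n.pos).symm
  have h4 : ((a n).factorial : K) ≠ 0 := by exact_mod_cast Nat.factorial_ne_zero _
  exact mul_ne_zero (mul_ne_zero (pow_ne_zero _ h1) h4) (pow_ne_zero _ (div_ne_zero h2 h3))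

lemma macdonaldForm_basis_left (a : ℕ+ →₀ ℕ) (g : SymFun K) :
    macdonaldForm q t (powerSumBasis K a) g = powerSumNorm q t a * (powerSumBasis K).repr g a := by
  classical
  suffices h : macdonaldForm q t (powerSumBasis K a) =
      powerSumNorm q t a • (powerSumBasis K).coord a from LinearMap.congr_fun h g
  refine (powerSumBasis K).ext fun b => ?_
  simp [macdonaldForm, Finsupp.single_apply, eq_comm]

lemma macdonaldForm_basis_right (f : SymFun K) (a : ℕ+ →₀ ℕ) :
    macdonaldForm q t f (powerSumBasis K a) = powerSumNorm q t a * (powerSumBasis K).repr f a := by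
  classical
  suffices h : (macdonaldForm q t).flip (powerSumBasis K a) =
      powerSumNorm q t a • (powerSumBasis K).coord a from LinearMap.congr_fun h f
  refine (powerSumBasis K).ext fun b => ?_
  simp only [macdonaldForm, LinearMap.flip_apply, Module.Basis.constr_basis, LinearMap.smul_apply,
    Module.Basis.coord_apply, Module.Basis.repr_self, Finsupp.single_apply, smul_eq_mul]
  split_ifs with h
  · rw [h, mul_one]
  · rw [mul_zero]

lemma eq_of_macdonaldForm_eq (hq : ∀ n : ℕ, 0 < n → q ^ n ≠ 1) (ht : ∀ n : ℕ, 0 < n → t ^ n ≠ 1)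
    {f f' : SymFun K} (h : ∀ g, macdonaldForm q t f g = macdonaldForm q t f' g) : f = f' := by
  refine (powerSumBasis K).ext_elem fun a => ?_
  have h1 := h (powerSumBasis K a)
  rw [macdonaldForm_basis_right, macdonaldForm_basis_right] at h1
  exact mul_left_cancel₀ (powerSumNorm_ne_zero hq ht a) h1

lemma macdonaldForm_conjugate (f g h : SymFun K) :
    macdonaldForm q t (conjugate q t (mulOp f) g) h = macdonaldForm q t g (f * h) :=
  isConjugate_conjugate_mulOp q t f g h

/-- The algebra homomorphism sending a symmetric function to the conjugate of its multiplication
operator. -/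
noncomputable def conjugateHom (hq : ∀ n : ℕ, 0 < n → q ^ n ≠ 1)
    (ht : ∀ n : ℕ, 0 < n → t ^ n ≠ 1) : SymFun K →ₐ[K] Module.End K (SymFun K) :=
  AlgHom.ofLinearMap
    { toFun := fun f => conjugate q t (mulOp f)
      map_add' := fun f g => LinearMap.ext fun v => eq_of_macdonaldForm_eq hq ht fun h => by
        rw [LinearMap.add_apply, map_add, LinearMap.add_apply, macdonaldForm_conjugate,
          macdonaldForm_conjugate, macdonaldForm_conjugate, add_mul, map_add]
      map_smul' := fun c f => LinearMap.ext fun v => eq_of_macdonaldForm_eq hq ht fun h => by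
        rw [RingHom.id_apply, LinearMap.smul_apply, map_smul, LinearMap.smul_apply,
          macdonaldForm_conjugate, macdonaldForm_conjugate, smul_mul_assoc, map_smul] }
    (LinearMap.ext fun v => eq_of_macdonaldForm_eq hq ht fun h => by
      change macdonaldForm q t (conjugate q t (mulOp 1) v) h = macdonaldForm q t v h
      rw [macdonaldForm_conjugate, one_mul])
    -- Conjugation reverses products, but multiplication operators commute, so the result is still a
    -- homomorphism.
    (fun f g => LinearMap.ext fun v => eq_of_macdonaldForm_eq hq ht fun h => by
      change macdonaldForm q t (conjugate q t (mulOp (f * g)) v) h = macdonaldForm q t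
        (conjugate q t (mulOp f) (conjugate q t (mulOp g) v)) h
      rw [macdonaldForm_conjugate, macdonaldForm_conjugate, macdonaldForm_conjugate, mul_assoc,
        mul_left_comm])

lemma conjugateHom_apply (hq : ∀ n : ℕ, 0 < n → q ^ n ≠ 1) (ht : ∀ n : ℕ, 0 < n → t ^ n ≠ 1)
    (f : SymFun K) : conjugateHom hq ht f = conjugate q t (mulOp f) := rfl

/-- This is the source of all finiteness: `⟨f^* v, h⟩ = ⟨v, f h⟩` vanishes once the order of `f`
exceeds the largest weight `D` of a power sum product in `v`. -/
lemma exists_conjugateHom_eq_zero (hq : ∀ n : ℕ, 0 < n → q ^ n ≠ 1)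
    (ht : ∀ n : ℕ, 0 < n → t ^ n ≠ 1) (v : SymFun K) :
    ∃ D : ℕ, ∀ n, D < n → ∀ f ∈ orderGE n, conjugateHom hq ht f v = 0 := by
  let wt : (ℕ+ →₀ ℕ) → ℕ := fun a => a.sum fun n k => (n : ℕ) * k
  refine ⟨((powerSumBasis K).repr v).support.sup wt, fun n hn f hf =>
    eq_of_macdonaldForm_eq hq ht fun h => ?_⟩
  rw [conjugateHom_apply, macdonaldForm_conjugate, map_zero, LinearMap.zero_apply]
  conv_lhs => rw [← (powerSumBasis K).linearCombination_repr v]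
  rw [Finsupp.linearCombination_apply, Finsupp.sum, map_sum, LinearMap.sum_apply]
  refine Finset.sum_eq_zero fun a ha => ?_
  rw [map_smul, LinearMap.smul_apply, macdonaldForm_basis_left, repr_eq_zero_of_mem_orderGE
    (n := n) (f := f * h), mul_zero, smul_zero]
  · simpa using mul_mem_orderGE hf (mem_orderGE_zero h)
  · exact (Finset.le_sup (f := wt) ha).trans_lt hn

end Adjoint

/-! ### `A^(k)` and `S^(k)` on a vector, as finite sums graded by degree. -/

section Expansions

variable {K : Type*} [Field K]

lemma opSum_apply {ι : Type*} {T : ι → Module.End K (SymFun K)} (h : PointwiseFinite T)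
    (f : SymFun K) : opSum T f = ∑ᶠ i, T i f := by
  rw [opSum, dif_pos h]
  rfl

lemma prod_ofFn_mulOp {k : ℕ} (f : Fin k → SymFun K) :
    (List.ofFn fun i => mulOp (f i)).prod = mulOp (∏ i, f i) := by
  have h := map_list_prod (Algebra.lmul K (SymFun K)) (List.ofFn f)
  rw [List.map_ofFn, List.prod_ofFn] at h
  exact h.symm

variable [CharZero K] {q t : K} (hq : ∀ n : ℕ, 0 < n → q ^ n ≠ 1)
  (ht : ∀ n : ℕ, 0 < n → t ^ n ≠ 1)

lemma prod_ofFn_conjugate {k : ℕ} (f : Fin k → SymFun K) :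
    (List.ofFn fun i => conjugate q t (mulOp (f i))).prod = conjugateHom hq ht (∏ i, f i) := by
  have h := map_list_prod (conjugateHom hq ht) (List.ofFn f)
  rw [List.map_ofFn, List.prod_ofFn] at h
  exact h.symm

lemma termS_apply {k : ℕ} (m n : Fin k → ℕ) (v : SymFun K) :
    termS q t m n v = (coeffF t (fun i => (n i : ℤ) - m i) * q⁻¹ ^ ∑ i, n i) •
      ((∏ i, oneRowQ t (m i)) * conjugateHom hq ht (∏ i, oneRowQ t (n i)) v) := by
  rw [termS, prod_ofFn_mulOp, prod_ofFn_conjugate hq ht]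
  rfl

/-- The value at `v` of the operator `Q_λ Q_λ^*`. -/
noncomputable def hallLittlewoodSq (v : SymFun K) {k : ℕ} (l : Fin k → ℕ) : SymFun K :=
  hallLittlewoodQ t l * conjugateHom hq ht (hallLittlewoodQ t l) v

lemma termA_apply {k : ℕ} (l : PartitionOfLength k) (v : SymFun K) :
    termA q t l v = q⁻¹ ^ (∑ i, l.1 i) •
      ((hallLittlewoodB t l.1)⁻¹ • hallLittlewoodSq hq ht v l.1) := by
  have h : conjugate q t (mulOp (hallLittlewoodP t l.1)) =
      (hallLittlewoodB t l.1)⁻¹ • conjugateHom hq ht (hallLittlewoodQ t l.1) := by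
    rw [← conjugateHom_apply hq ht, hallLittlewoodP, map_smul]
  rw [termA, h, hallLittlewoodSq, mul_smul_comm]
  rfl

open Classical in
/-- The partitions of `d` with exactly `k` parts. -/
noncomputable def strictPartitions (k d : ℕ) : Finset (Fin k → ℕ) :=
  (paddedPartitions k d).filter fun l => ∀ i, 0 < l i

lemma mem_strictPartitions {k d : ℕ} {l : Fin k → ℕ} :
    l ∈ strictPartitions k d ↔ (Antitone l ∧ ∀ i, 0 < l i) ∧ ∑ i, l i = d := by
  rw [strictPartitions, Finset.mem_filter, mem_paddedPartitions]
  tauto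

section Bound

variable {v : SymFun K} {D : ℕ} (hD : ∀ n, D < n → ∀ f ∈ orderGE n, conjugateHom hq ht f v = 0)
include hD

lemma sum_le_of_termA_ne_zero {k : ℕ} {l : PartitionOfLength k} (h : termA q t l v ≠ 0) :
    ∑ i, l.1 i ≤ D := by
  by_contra! hc
  rw [termA_apply hq ht, hallLittlewoodSq, hD _ hc _ (hallLittlewoodQ_mem_orderGE t l.1)] at h
  simp at h

lemma sum_le_of_termS_ne_zero {k : ℕ} {m n : Fin k → ℕ} (h : termS q t m n v ≠ 0) :
    ∑ i, n i ≤ D ∧ ∑ i, m i = ∑ i, n i := by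
  rw [termS_apply hq ht] at h
  constructor
  · by_contra! hc
    rw [hD _ hc _ (prod_oneRowQ_mem_orderGE t n)] at h
    simp at h
  · have h1 := sum_eq_zero_of_coeffF_ne_zero t (left_ne_zero_of_mul (left_ne_zero_of_smul h))
    rw [Finset.sum_sub_distrib, sub_eq_zero] at h1
    exact_mod_cast h1.symm

end Bound

/-- The tuples of length `k` and sum at most `D`. -/
def tuplesLE (k D : ℕ) : Finset (Fin k → ℕ) :=
  (Finset.range (D + 1)).biUnion fun d => Finset.piAntidiag Finset.univ d

lemma mem_tuplesLE {k D : ℕ} {l : Fin k → ℕ} : l ∈ tuplesLE k D ↔ ∑ i, l i ≤ D := by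
  simp [tuplesLE]

include hq ht in
lemma pointwiseFinite_termA (k : ℕ) :
    PointwiseFinite fun l : PartitionOfLength k => termA q t l := by
  intro v
  obtain ⟨D, hD⟩ := exists_conjugateHom_eq_zero hq ht v
  refine ((tuplesLE k D).finite_toSet.preimage Subtype.val_injective.injOn).subset fun l hl => ?_
  exact mem_tuplesLE.2 (sum_le_of_termA_ne_zero hq ht hD hl)

include hq ht in
lemma pointwiseFinite_termS (k : ℕ) :
    PointwiseFinite fun mn : (Fin k → ℕ) × (Fin k → ℕ) => termS q t mn.1 mn.2 := by
  intro v
  obtain ⟨D, hD⟩ := exists_conjugateHom_eq_zero hq ht v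
  refine (tuplesLE k D ×ˢ tuplesLE k D).finite_toSet.subset fun mn hmn => ?_
  obtain ⟨h1, h2⟩ := sum_le_of_termS_ne_zero hq ht hD hmn
  rw [Finset.mem_coe, Finset.mem_product, mem_tuplesLE, mem_tuplesLE]
  exact ⟨h2.trans_le h1, h1⟩

section Bound

variable {v : SymFun K} {D : ℕ} (hD : ∀ n, D < n → ∀ f ∈ orderGE n, conjugateHom hq ht f v = 0)
include hD

lemma opA_apply_eq_sum (k : ℕ) : opA q t k v = ∑ d ∈ Finset.range (D + 1), q⁻¹ ^ d •
    ∑ l ∈ strictPartitions k d, (hallLittlewoodB t l)⁻¹ • hallLittlewoodSq hq ht v l := by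
  classical
  rw [opA, opSum_apply (pointwiseFinite_termA hq ht k)]
  have hmem (l : PartitionOfLength k) (d : ℕ) :
      l ∈ (strictPartitions k d).subtype _ ↔ ∑ i, l.1 i = d := by
    rw [Finset.mem_subtype, mem_strictPartitions, and_iff_right l.2]
  rw [finsum_eq_sum_of_support_subset (s := (Finset.range (D + 1)).biUnion fun d =>
    (strictPartitions k d).subtype _), Finset.sum_biUnion]
  · refine Finset.sum_congr rfl fun d _ => ?_
    rw [Finset.smul_sum, ← Finset.sum_subtype_of_mem (p := fun l => Antitone l ∧ ∀ i, 0 < l i)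
      (s := strictPartitions k d) _ fun l hl => (mem_strictPartitions.1 hl).1]
    refine Finset.sum_congr rfl fun l hl => ?_
    rw [termA_apply hq ht, (hmem l d).1 hl]
  · intro d _ d' _ hne
    refine Finset.disjoint_left.2 fun l hl hl' => hne ?_
    rw [← (hmem l d).1 hl, (hmem l d').1 hl']
  · intro l hl
    rw [Finset.mem_coe, Finset.mem_biUnion]
    exact ⟨∑ i, l.1 i, Finset.mem_range.2 (Nat.lt_succ_of_le
      (sum_le_of_termA_ne_zero hq ht hD hl)), (hmem l _).2 rfl⟩

/-- `F` has degree zero, so only `|m| = |n| = d` contributes, and the conjugate factor kills `v`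
when `d > D`. -/
lemma opS_apply_eq_sum (k : ℕ) : opS q t k v = ∑ d ∈ Finset.range (D + 1), q⁻¹ ^ d •
    ∑ n ∈ Finset.piAntidiag Finset.univ d, ∑ m ∈ Finset.piAntidiag Finset.univ d,
      coeffF t (fun i => (n i : ℤ) - m i) •
        ((∏ i : Fin k, oneRowQ t (m i)) * conjugateHom hq ht (∏ i, oneRowQ t (n i)) v) := by
  classical
  rw [opS, opSum_apply (pointwiseFinite_termS hq ht k)]
  have hmem (m : Fin k → ℕ) (d : ℕ) :
      m ∈ Finset.piAntidiag Finset.univ d ↔ ∑ i, m i = d := by simp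
  rw [finsum_eq_sum_of_support_subset (s := (Finset.range (D + 1)).biUnion fun d =>
    Finset.piAntidiag Finset.univ d ×ˢ Finset.piAntidiag Finset.univ d), Finset.sum_biUnion]
  · refine Finset.sum_congr rfl fun d _ => ?_
    rw [Finset.sum_product_right, Finset.smul_sum]
    refine Finset.sum_congr rfl fun n hn => ?_
    rw [Finset.smul_sum]
    refine Finset.sum_congr rfl fun m _ => ?_
    rw [termS_apply hq ht, (hmem n d).1 hn, smul_smul, mul_comm]
  · intro d _ d' _ hne
    refine Finset.disjoint_left.2 fun l hl hl' => hne ?_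
    rw [← (hmem _ d).1 (Finset.mem_product.1 hl).1, (hmem _ d').1 (Finset.mem_product.1 hl').1]
  · intro mn hmn
    obtain ⟨h1, h2⟩ := sum_le_of_termS_ne_zero hq ht hD hmn
    rw [Finset.mem_coe, Finset.mem_biUnion]
    exact ⟨∑ i, mn.2 i, Finset.mem_range.2 (Nat.lt_succ_of_le h1),
      Finset.mem_product.2 ⟨(hmem _ _).2 h2, (hmem _ _).2 rfl⟩⟩

end Bound

/-- After diagonalization the coefficients are products of a function of `m` and a function of `n`,
so the double sum factors as `Q_μ` times `Q_μ^* v`. -/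
lemma sum_coeffF_smul_eq_hallLittlewoodSq (v : SymFun K) (k d : ℕ) :
    ∑ n ∈ Finset.piAntidiag Finset.univ d, ∑ m ∈ Finset.piAntidiag Finset.univ d,
      coeffF t (fun i => (n i : ℤ) - m i) •
        ((∏ i : Fin k, oneRowQ t (m i)) * conjugateHom hq ht (∏ i, oneRowQ t (n i)) v) =
    ∑ μ ∈ paddedPartitions k d, (qPoch t t k / hallLittlewoodB t μ) •
      hallLittlewoodSq hq ht v μ := by
  rw [sum_coeffF_smul_eq ht (fun m n => (∏ i : Fin k, oneRowQ t (m i)) *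
    conjugateHom hq ht (∏ i, oneRowQ t (n i)) v)]
  · refine Finset.sum_congr rfl fun μ hμ => ?_
    congr 1
    rw [hallLittlewoodSq, hallLittlewoodQ_eq_sum, (mem_paddedPartitions.1 hμ).2, map_sum,
      LinearMap.sum_apply, Finset.mul_sum]
    refine Finset.sum_congr rfl fun n _ => ?_
    rw [Finset.sum_mul]
    refine Finset.sum_congr rfl fun m _ => ?_
    rw [map_smul, LinearMap.smul_apply, smul_mul_assoc, mul_smul_comm, smul_smul]
  · intro m n σ
    congr 1
    exact Equiv.prod_comp σ fun i => oneRowQ t (m i)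
  · intro m n σ
    congr 3
    exact Equiv.prod_comp σ fun i => oneRowQ t (n i)

lemma hallLittlewoodSq_snoc_zero (v : SymFun K) {k : ℕ} (l : Fin k → ℕ) :
    hallLittlewoodSq hq ht v (Fin.snoc l 0 : Fin (k + 1) → ℕ) = hallLittlewoodSq hq ht v l := by
  rw [hallLittlewoodSq, hallLittlewoodQ_snoc_zero, hallLittlewoodSq]

end Expansions

/-! ### Grouping padded partitions by their number of nonzero parts. -/

section Strip

variable {K : Type*} [Field K] {t : K}

/-- The number of zero entries of a tuple. -/
def zeroCount {k : ℕ} (l : Fin k → ℕ) : ℕ := (Finset.univ.val.map l).count 0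

variable (t) in
/-- `b_λ(t)`, ignoring the zero entries of `λ`. -/
noncomputable def positiveB {k : ℕ} (l : Fin k → ℕ) : K :=
  multiplicityPoch t ((Finset.univ.val.map l).filter (0 < ·))

lemma map_snoc_univ {k : ℕ} (α : Fin k → ℕ) (a : ℕ) :
    Finset.univ.val.map (Fin.snoc α a : Fin (k + 1) → ℕ) = a ::ₘ Finset.univ.val.map α := by
  rw [Fin.univ_castSuccEmb]
  simp

lemma hallLittlewoodB_eq_mul {k : ℕ} (l : Fin k → ℕ) :
    hallLittlewoodB t l = positiveB t l * qPoch t t (zeroCount l) := by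
  rw [hallLittlewoodB_eq, positiveB, zeroCount]
  generalize Finset.univ.val.map l = s
  rw [multiplicityPoch, multiplicityPoch]
  have h1 : ∏ a ∈ s.toFinset, qPoch t t (s.count a) =
      ∏ a ∈ insert 0 s.toFinset, qPoch t t (s.count a) := by
    refine Finset.prod_subset (Finset.subset_insert _ _) fun a _ ha => ?_
    rw [Multiset.count_eq_zero_of_notMem (fun h => ha (Multiset.mem_toFinset.2 h))]
    simp [qPoch]
  rw [h1, ← Finset.mul_prod_erase _ _ (Finset.mem_insert_self 0 _), mul_comm]
  congr 1
  refine Finset.prod_congr ?_ fun a ha => ?_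
  · ext a
    simp [Nat.pos_iff_ne_zero]
    tauto
  · rw [Multiset.count_filter_of_pos]
    exact (Multiset.mem_filter.1 (Multiset.mem_toFinset.1 ha)).2

lemma zeroCount_snoc_zero {k : ℕ} (l : Fin k → ℕ) :
    zeroCount (Fin.snoc l 0 : Fin (k + 1) → ℕ) = zeroCount l + 1 := by
  rw [zeroCount, map_snoc_univ, Multiset.count_cons_self, zeroCount]

lemma positiveB_snoc_zero {k : ℕ} (l : Fin k → ℕ) :
    positiveB t (Fin.snoc l 0 : Fin (k + 1) → ℕ) = positiveB t l := by
  rw [positiveB, map_snoc_univ, Multiset.filter_cons_of_neg _ (lt_irrefl 0), positiveB]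

lemma zeroCount_eq_zero {k : ℕ} {l : Fin k → ℕ} (h : ∀ i, 0 < l i) : zeroCount l = 0 := by
  refine Multiset.count_eq_zero_of_notMem fun h0 => ?_
  obtain ⟨i, _, hi⟩ := Multiset.mem_map.1 h0
  exact (h i).ne' hi

lemma sum_paddedPartitions_succ {M : Type*} [AddCommMonoid M] (k d : ℕ)
    (f : (Fin (k + 1) → ℕ) → M) : ∑ μ ∈ paddedPartitions (k + 1) d, f μ =
      ∑ μ ∈ paddedPartitions k d, f (Fin.snoc μ 0) + ∑ μ ∈ strictPartitions (k + 1) d, f μ := by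
  classical
  rw [strictPartitions, ← Finset.sum_filter_not_add_sum_filter _ fun l : Fin (k + 1) → ℕ =>
    ∀ i, 0 < l i]
  congr 1
  have hsum (m : Fin k → ℕ) : ∑ i, (Fin.snoc m 0 : Fin (k + 1) → ℕ) i = ∑ i, m i := by
    rw [Fin.sum_univ_castSucc]
    simp
  symm
  refine Finset.sum_bij' (fun μ _ => (Fin.snoc μ 0 : Fin (k + 1) → ℕ)) (fun μ _ => Fin.init μ)
    ?_ ?_ ?_ ?_ ?_
  · intro μ hμ
    rw [mem_paddedPartitions] at hμ
    rw [Finset.mem_filter, mem_paddedPartitions, hsum]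
    refine ⟨⟨?_, hμ.2⟩, fun h => ?_⟩
    · intro i j hij
      induction j using Fin.lastCases with
      | last => simp
      | cast j =>
        induction i using Fin.lastCases with
        | last => exact absurd hij (not_le.2 (Fin.castSucc_lt_last j))
        | cast i => simpa using hμ.1 (Fin.castSucc_le_castSucc_iff.1 hij)
    · simpa using h (Fin.last k)
  · intro μ hμ
    rw [Finset.mem_filter, mem_paddedPartitions] at hμ
    obtain ⟨⟨h1, h2⟩, h3⟩ := hμ
    push Not at h3
    obtain ⟨i, hi⟩ := h3
    have h0 : μ (Fin.last k) = 0 := by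
      have := h1 (Fin.le_last i)
      omega
    rw [mem_paddedPartitions]
    refine ⟨fun i j hij => h1 (Fin.castSucc_le_castSucc_iff.2 hij), ?_⟩
    rw [Fin.sum_univ_castSucc, h0, add_zero] at h2
    exact h2
  · intro μ _
    simp
  · intro μ hμ
    rw [Finset.mem_filter, mem_paddedPartitions] at hμ
    obtain ⟨⟨h1, h2⟩, h3⟩ := hμ
    push Not at h3
    obtain ⟨i, hi⟩ := h3
    have h0 : μ (Fin.last k) = 0 := by
      have := h1 (Fin.le_last i)
      omega
    rw [← h0]
    exact Fin.snoc_init_self μ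
  · intro _ _
    rfl

lemma sum_strictPartitions_eq {M : Type*} [AddCommGroup M] [Module K M] (g : ℕ → K) (k d : ℕ)
    (R : (Fin k → ℕ) → M) : ∑ μ ∈ strictPartitions k d, (g (zeroCount μ) / positiveB t μ) • R μ =
      g 0 • ∑ μ ∈ strictPartitions k d, (hallLittlewoodB t μ)⁻¹ • R μ := by
  rw [Finset.smul_sum]
  refine Finset.sum_congr rfl fun μ hμ => ?_
  have h0 := zeroCount_eq_zero (mem_strictPartitions.1 hμ).1.2
  rw [hallLittlewoodB_eq_mul, h0, smul_smul, div_eq_mul_inv]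
  simp [qPoch]

/-- Strip trailing zeros one at a time. The function `g` of the number of zeros is left arbitrary
because each stripped zero shifts its argument by one. -/
lemma sum_paddedPartitions_eq {M : Type*} [AddCommGroup M] [Module K M]
    (R : ∀ k : ℕ, (Fin k → ℕ) → M)
    (hR : ∀ (k : ℕ) (l : Fin k → ℕ), R (k + 1) (Fin.snoc l 0) = R k l) (g : ℕ → K) (k d : ℕ) :
    ∑ μ ∈ paddedPartitions k d, (g (zeroCount μ) / positiveB t μ) • R k μ =
      ∑ i ∈ Finset.range (k + 1), g (k - i) •
        ∑ μ ∈ strictPartitions i d, (hallLittlewoodB t μ)⁻¹ • R i μ := by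
  induction k generalizing g with
  | zero =>
    have h : paddedPartitions 0 d = strictPartitions 0 d :=
      (Finset.filter_true_of_mem fun l _ i => i.elim0).symm
    rw [h, sum_strictPartitions_eq]
    simp
  | succ k ih =>
    rw [sum_paddedPartitions_succ, sum_strictPartitions_eq, Finset.sum_range_succ _ (k + 1),
      Nat.sub_self]
    congr 1
    simp only [zeroCount_snoc_zero, positiveB_snoc_zero, hR]
    rw [ih fun n => g (n + 1)]
    refine Finset.sum_congr rfl fun i hi => ?_
    rw [Nat.succ_sub (Nat.lt_succ_iff.1 (Finset.mem_range.1 hi))]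

end Strip

/-! ### The expression of `S^(k)` through the `A^(i)`. -/

section Relation

variable {K : Type*} [Field K] [CharZero K] {q t : K}

lemma opS_eq_sum_opA (hq : ∀ n : ℕ, 0 < n → q ^ n ≠ 1) (ht : ∀ n : ℕ, 0 < n → t ^ n ≠ 1) (k : ℕ) :
    opS q t k = ∑ i ∈ Finset.range (k + 1), (qPoch t t k / qPoch t t (k - i)) • opA q t i := by
  refine LinearMap.ext fun v => ?_
  obtain ⟨D, hD⟩ := exists_conjugateHom_eq_zero hq ht v
  rw [opS_apply_eq_sum hq ht hD, LinearMap.sum_apply]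
  simp only [sum_coeffF_smul_eq_hallLittlewoodSq, LinearMap.smul_apply,
    opA_apply_eq_sum hq ht hD, Finset.smul_sum (r := (_ / _ : K))]
  rw [Finset.sum_comm]
  refine Finset.sum_congr rfl fun d _ => ?_
  simp only [smul_comm (_ / _ : K) (q⁻¹ ^ d)]
  rw [← Finset.smul_sum]
  congr 1
  -- Separating the factor of the zeros from `b_μ` produces the denominator `(t;t)_{k-i}`.
  have h (μ : Fin k → ℕ) : qPoch t t k / hallLittlewoodB t μ =
      (qPoch t t k / qPoch t t (zeroCount μ)) / positiveB t μ := by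
    rw [hallLittlewoodB_eq_mul, div_div, mul_comm]
  simp only [h]
  exact sum_paddedPartitions_eq (fun k => hallLittlewoodSq hq ht v)
    (fun k l => hallLittlewoodSq_snoc_zero hq ht v l) (fun n => qPoch t t k / qPoch t t n) k d

end Relation

/-! ### Euler's expansion of `(v; t)_∞`. -/

section Euler

variable {K : Type*} [Field K] {t : K}

variable (t) in
/-- The expansion of `(v; t)_∞` as a power series in `v` given by Euler's identity. -/
noncomputable def eulerSeries : PowerSeries K :=
  PowerSeries.mk fun n => (-1) ^ n * t ^ n.choose 2 / qPoch t t n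

lemma coeff_eulerSeries (n : ℕ) : PowerSeries.coeff n (eulerSeries t) =
    (-1) ^ n * t ^ n.choose 2 / qPoch t t n := PowerSeries.coeff_mk _ _

lemma choose_two_succ (n : ℕ) : (n + 1).choose 2 = n + n.choose 2 := by
  rw [Nat.choose_succ_succ' n 1, Nat.choose_one_right]

lemma choose_two_add (k m : ℕ) : (k + m).choose 2 = k.choose 2 + m.choose 2 + k * m := by
  induction m with
  | zero => simp
  | succ m ih =>
    rw [← add_assoc, choose_two_succ, ih, choose_two_succ]
    ring

/-- The functional equation `E(v) = (1 - v) E(t v)` of the infinite product; its iterates split off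
the first `N` factors. -/
lemma eulerSeries_eq_mul_rescale (ht : ∀ n : ℕ, 0 < n → t ^ n ≠ 1) : eulerSeries t =
    (1 - PowerSeries.X) * PowerSeries.rescale t (eulerSeries t) := by
  ext n
  rw [sub_mul, one_mul, map_sub, PowerSeries.coeff_rescale]
  cases n with
  | zero => simp
  | succ n =>
    rw [PowerSeries.coeff_succ_X_mul, PowerSeries.coeff_rescale, coeff_eulerSeries,
      coeff_eulerSeries, qPoch_succ, choose_two_succ]
    have h1 := qPoch_ne_zero ht n
    have h2 : 1 - t ^ (n + 1) ≠ 0 := sub_ne_zero.2 (ht (n + 1) n.succ_pos).symm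
    field_simp
    ring

lemma eulerSeries_eq_prod_mul (ht : ∀ n : ℕ, 0 < n → t ^ n ≠ 1) (N : ℕ) : eulerSeries t =
    (∏ j ∈ Finset.range N, (1 - PowerSeries.C (t ^ j) * PowerSeries.X)) *
      PowerSeries.rescale (t ^ N) (eulerSeries t) := by
  induction N with
  | zero => simp [PowerSeries.rescale_one]
  | succ N ih =>
    have h := congrArg (PowerSeries.rescale (t ^ N)) (eulerSeries_eq_mul_rescale ht)
    rw [map_mul, map_sub, map_one, PowerSeries.rescale_X, PowerSeries.rescale_rescale,
      ← pow_succ'] at h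
    rw [h, ← mul_assoc, ← Finset.prod_range_succ] at ih
    exact ih

end Euler

/-! ### Ultrametric estimates for the partial products. -/

section Convergence

variable {K Γ : Type*} [Field K] [LinearOrderedCommGroupWithZero Γ]

/-- The power series all of whose coefficients have valuation at most `r`. -/
def coeffBall (v : Valuation K Γ) (r : Γ) : AddSubgroup (PowerSeries K) where
  carrier := {p | ∀ d, v (PowerSeries.coeff d p) ≤ r}
  add_mem' := fun {p p'} hp hp' d => by
    rw [map_add]
    exact (v.map_add _ _).trans (max_le (hp d) (hp' d))
  zero_mem' := fun d => by simp
  neg_mem' := fun {p} hp d => by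
    rw [map_neg, Valuation.map_neg]
    exact hp d

lemma mul_mem_coeffBall {v : Valuation K Γ} {r s : Γ} {p p' : PowerSeries K}
    (hp : p ∈ coeffBall v r) (hp' : p' ∈ coeffBall v s) : p * p' ∈ coeffBall v (r * s) := by
  intro d
  rw [PowerSeries.coeff_mul]
  refine v.map_sum_le fun x _ => ?_
  rw [map_mul]
  exact mul_le_mul' (hp _) (hp' _)

lemma one_mem_coeffBall (v : Valuation K Γ) : 1 ∈ coeffBall v 1 := by
  intro d
  rw [PowerSeries.coeff_one]
  split_ifs <;> simp

lemma coeffBall_mono (v : Valuation K Γ) {r s : Γ} (h : r ≤ s) : coeffBall v r ≤ coeffBall v s :=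
  fun _ hp d => (hp d).trans h

variable {v : Valuation K Γ} {t : K}

lemma prod_sub_one_mem_coeffBall (hv : v t ≤ 1) (N : ℕ) (S : Finset ℕ) (hS : ∀ j ∈ S, N ≤ j) :
    ∏ j ∈ S, (1 - PowerSeries.C (t ^ j) * PowerSeries.X) - 1 ∈ coeffBall v (v (t ^ N)) := by
  classical
  induction S using Finset.induction_on with
  | empty => simp [zero_mem]
  | insert j S hj ih =>
    have hN : v (t ^ N) ≤ 1 := by rw [map_pow]; exact pow_le_one' hv N
    have h1 : PowerSeries.C (t ^ j) * PowerSeries.X ∈ coeffBall v (v (t ^ N)) := by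
      intro d
      rw [PowerSeries.coeff_C_mul, PowerSeries.coeff_X]
      split_ifs
      · rw [mul_one, map_pow, map_pow]
        exact pow_le_pow_right_of_le_one' hv (hS j (Finset.mem_insert_self j S))
      · simp
    have h2 := ih fun i hi => hS i (Finset.mem_insert_of_mem hi)
    have h3 := coeffBall_mono v (mul_le_of_le_one_right' hN) (mul_mem_coeffBall h1 h2)
    rw [Finset.prod_insert hj]
    convert sub_mem (sub_mem h2 h1) h3 using 1
    ring

lemma valuation_one_sub_pow (hv : v t < 1) {n : ℕ} (hn : 0 < n) : v (1 - t ^ n) = 1 := by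
  refine v.map_one_sub_of_lt ?_
  rw [map_pow]
  exact pow_lt_one₀ zero_le hv hn.ne'

lemma valuation_qPoch (hv : v t < 1) (n : ℕ) : v (qPoch t t n) = 1 := by
  rw [qPoch, map_prod]
  refine Finset.prod_eq_one fun j _ => ?_
  rw [← pow_succ', valuation_one_sub_pow hv j.succ_pos]

lemma rescale_eulerSeries_sub_one_mem_coeffBall (hv : v t < 1) (N : ℕ) :
    PowerSeries.rescale (t ^ N) (eulerSeries t) - 1 ∈ coeffBall v (v (t ^ N)) := by
  intro d
  rw [map_sub, PowerSeries.coeff_rescale, coeff_eulerSeries, PowerSeries.coeff_one]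
  cases d with
  | zero => simp [qPoch]
  | succ d =>
    have h1 : v (t ^ N) ≤ 1 := by rw [map_pow]; exact pow_le_one' hv.le N
    have h2 : v ((t ^ N) ^ (d + 1)) ≤ v (t ^ N) := by
      rw [map_pow, pow_succ]
      exact mul_le_of_le_one_left' (pow_le_one' h1 d)
    have h3 : v ((-1) ^ (d + 1) * t ^ (d + 1).choose 2 / qPoch t t (d + 1)) ≤ 1 := by
      rw [map_div₀, valuation_qPoch hv, div_one, map_mul, map_pow, Valuation.map_neg, map_one,
        one_pow, one_mul, map_pow]
      exact pow_le_one' hv.le _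
    rw [if_neg (Nat.succ_ne_zero d), sub_zero, map_mul]
    exact (mul_le_mul' h2 h3).trans_eq (mul_one _)

/-- Both series share the first `N` factors, whose coefficients are integral, and both cofactors
agree with `1` up to coefficients of valuation at most `v (t ^ N)`. -/
lemma prod_sub_eulerSeries_mem_coeffBall (hv : v t < 1) (ht : ∀ n : ℕ, 0 < n → t ^ n ≠ 1) (N : ℕ)
    (S : Finset ℕ) (hS : Finset.range N ⊆ S) :
    ∏ j ∈ S, (1 - PowerSeries.C (t ^ j) * PowerSeries.X) - eulerSeries t ∈
      coeffBall v (v (t ^ N)) := by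
  classical
  have h1 := prod_sub_one_mem_coeffBall hv.le N (S \ Finset.range N) fun j hj => by
    simpa using (Finset.mem_sdiff.1 hj).2
  have h2 := rescale_eulerSeries_sub_one_mem_coeffBall hv N
  have h3 : ∏ j ∈ Finset.range N, (1 - PowerSeries.C (t ^ j) * PowerSeries.X) ∈
      coeffBall v 1 := by
    have h4 := prod_sub_one_mem_coeffBall hv.le 0 (Finset.range N) fun j _ => Nat.zero_le j
    rw [pow_zero, map_one] at h4
    have h5 := add_mem h4 (one_mem_coeffBall v)
    rwa [sub_add_cancel] at h5
  have h4 := mul_mem_coeffBall h3 (sub_mem h1 h2)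
  rw [one_mul] at h4
  rw [← Finset.prod_sdiff hS]
  conv in eulerSeries t => rw [eulerSeries_eq_prod_mul ht N]
  convert h4 using 1
  ring

end Convergence

/-! ### The parameters of `ℚ(q)(t)` and the infinite product there. -/

section QQqt

lemma valuation_tPar : Valued.v tPar < 1 := by
  rw [RatFunc.v_def, tPar, Polynomial.valuation_X_eq_neg_one, ← WithZero.exp_zero,
    WithZero.exp_lt_exp]
  simp

lemma tPar_pow_ne_one (n : ℕ) (hn : 0 < n) : tPar ^ n ≠ 1 := by
  intro h
  have h1 := valuation_one_sub_pow valuation_tPar hn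
  rw [h, sub_self, map_zero] at h1
  exact zero_ne_one h1

lemma tPar_ne_zero : tPar ≠ 0 := RatFunc.X_ne_zero

lemma qPar_pow_ne_one (n : ℕ) (hn : 0 < n) : qPar ^ n ≠ 1 := by
  intro h
  rw [qPar, ← map_pow, ← map_one RatFunc.C] at h
  have h1 : (RatFunc.X : RatFunc ℚ) ^ n = 1 := RatFunc.C_injective h
  have h2 : algebraMap (Polynomial ℚ) (RatFunc ℚ) (Polynomial.X ^ n) =
      algebraMap (Polynomial ℚ) (RatFunc ℚ) 1 := by
    rw [map_pow, RatFunc.algebraMap_X, h1, map_one]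
  have h3 := congrArg Polynomial.natDegree (RatFunc.algebraMap_injective ℚ h2)
  rw [Polynomial.natDegree_X_pow, Polynomial.natDegree_one] at h3
  omega

open scoped PowerSeries.WithPiTopology

lemma hasProd_eulerSeries : HasProd (fun j : ℕ =>
    (1 - PowerSeries.C (tPar ^ j) * PowerSeries.X : PowerSeries QQqt)) (eulerSeries tPar) := by
  refine (PowerSeries.WithPiTopology.tendsto_iff_coeff_tendsto _ _ _ _).2 fun d => ?_
  intro s hs
  obtain ⟨γ, hγ⟩ := Valued.mem_nhds.1 hs
  have h0 := Valued.tendsto_zero_pow_of_v_lt_one valuation_tPar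
  have h1 := h0.eventually (Valued.mem_nhds_zero.2 ⟨γ, subset_rfl⟩)
  obtain ⟨N, hN⟩ := h1.exists
  refine Filter.mem_map.2 (Filter.mem_of_superset (Filter.mem_atTop (Finset.range N))
    fun S hS => hγ ?_)
  have h2 := prod_sub_eulerSeries_mem_coeffBall valuation_tPar tPar_pow_ne_one N S hS d
  rw [map_sub] at h2
  exact (Valued.v.restrict_le_iff.2 h2).trans_lt hN

lemma qPochInf_tPar : qPochInf tPar = eulerSeries tPar := hasProd_eulerSeries.tprod_eq

end QQqt

/-! ### The quotients `(u⁻¹; t)_∞ / (u; t⁻¹)_k`. -/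

section Laurent

variable {K : Type*} [Field K] {t : K}

variable (t) in
/-- `1 / (u; t⁻¹)_k` as a power series in `u⁻¹`. -/
noncomputable def invPoch (k : ℕ) : PowerSeries K :=
  PowerSeries.X ^ k * ∏ j ∈ Finset.range k, (PowerSeries.X - PowerSeries.C (t⁻¹ ^ j))⁻¹

lemma inv_laurentPoch (ht0 : t ≠ 0) (k : ℕ) :
    (laurentPoch t k)⁻¹ = HahnSeries.ofPowerSeries ℤ K (invPoch t k) := by
  let ι := HahnSeries.ofPowerSeries ℤ K
  refine inv_eq_of_mul_eq_one_right ?_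
  have h1 : PowerSeries.X ^ k = ∏ j ∈ Finset.range k, (PowerSeries.X : PowerSeries K) := by
    simp
  rw [invPoch, h1, ← Finset.prod_mul_distrib, map_prod, laurentPoch, qPoch,
    ← Finset.prod_mul_distrib]
  refine Finset.prod_eq_one fun j _ => ?_
  have h2 : HahnSeries.single (-1) 1 * ι PowerSeries.X = (1 : LaurentSeries K) := by
    rw [HahnSeries.ofPowerSeries_X, HahnSeries.single_mul_single]
    simp
  have h3 : (HahnSeries.C t⁻¹ : LaurentSeries K) ^ j = ι (PowerSeries.C (t⁻¹ ^ j)) := by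
    rw [HahnSeries.ofPowerSeries_C, map_pow]
  rw [map_mul, ← mul_assoc, sub_mul, one_mul, h3, mul_right_comm, h2, one_mul, ← map_sub,
    ← map_mul, PowerSeries.mul_inv_cancel, map_one]
  simp [ht0]

/-- With `X = u⁻¹`, each of the first `k` factors `1 - t^j X` equals `-t^j (X - t^{-j})` and cancels
against a denominator, leaving `(t^k X; t)_∞`. -/
lemma eulerSeries_mul_invPoch (ht0 : t ≠ 0) (ht : ∀ n : ℕ, 0 < n → t ^ n ≠ 1) (k : ℕ) :
    eulerSeries t * invPoch t k = PowerSeries.C ((-1) ^ k * t ^ k.choose 2) *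
      (PowerSeries.X ^ k * PowerSeries.rescale (t ^ k) (eulerSeries t)) := by
  have h1 (j : ℕ) : (1 - PowerSeries.C (t ^ j) * PowerSeries.X : PowerSeries K) *
      (PowerSeries.X - PowerSeries.C (t⁻¹ ^ j))⁻¹ = PowerSeries.C (-t ^ j) := by
    have h2 : (1 - PowerSeries.C (t ^ j) * PowerSeries.X : PowerSeries K) =
        PowerSeries.C (-t ^ j) * (PowerSeries.X - PowerSeries.C (t⁻¹ ^ j)) := by
      rw [mul_sub, ← map_mul, inv_pow, neg_mul, mul_inv_cancel₀ (pow_ne_zero j ht0)]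
      simp
      ring
    rw [h2, mul_assoc, PowerSeries.mul_inv_cancel, mul_one]
    simp [ht0]
  have h2 : ∏ j ∈ Finset.range k, PowerSeries.C (-t ^ j) =
      PowerSeries.C ((-1) ^ k * t ^ k.choose 2) := by
    rw [← map_prod]
    congr 1
    induction k with
    | zero => simp
    | succ k ih => rw [Finset.prod_range_succ, ih, choose_two_succ]; ring
  rw [← h2, ← Finset.prod_congr rfl fun j _ => h1 j, Finset.prod_mul_distrib]
  conv_lhs => rw [eulerSeries_eq_prod_mul ht k, invPoch]
  ring

lemma qPoch_eq_mul_qPoch_inv (ht0 : t ≠ 0) (n : ℕ) :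
    qPoch t t n = (-1) ^ n * t ^ n.choose 2 * (t ^ n * qPoch t⁻¹ t⁻¹ n) := by
  induction n with
  | zero => simp [qPoch]
  | succ n ih =>
    rw [qPoch_succ, qPoch_succ, ih, choose_two_succ, inv_pow]
    have : t ^ (n + 1) ≠ 0 := pow_ne_zero _ ht0
    field_simp
    ring

/-- The powers of `t` combine by `C(k+m, 2) = C(k, 2) + C(m, 2) + k m`, so `k` survives only in
`(t;t)_{n-k}`: the ratio is exactly the coefficient relating `S^(n)` to `A^(k)`. -/
lemma coeff_eulerSeries_mul_invPoch (ht0 : t ≠ 0) (ht : ∀ n : ℕ, 0 < n → t ^ n ≠ 1) {k n : ℕ}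
    (h : k ≤ n) : PowerSeries.coeff n (eulerSeries t * invPoch t k) =
      (t ^ n * qPoch t⁻¹ t⁻¹ n)⁻¹ * (qPoch t t n / qPoch t t (n - k)) := by
  obtain ⟨m, rfl⟩ := Nat.exists_eq_add_of_le h
  rw [eulerSeries_mul_invPoch ht0 ht, PowerSeries.coeff_C_mul, add_comm k m,
    PowerSeries.coeff_X_pow_mul, PowerSeries.coeff_rescale, coeff_eulerSeries, Nat.add_sub_cancel]
  have h1 := qPoch_ne_zero ht (m + k)
  have h2 := qPoch_ne_zero ht m
  have h3 := qPoch_eq_mul_qPoch_inv ht0 (m + k)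
  set x := t ^ (m + k) * qPoch t⁻¹ t⁻¹ (m + k)
  have h4 : x ≠ 0 := by
    intro hx
    rw [hx, mul_zero] at h3
    exact h1 h3
  rw [h3, add_comm m k, choose_two_add]
  field_simp
  ring

end Laurent

/-! ### The power series identity. -/

section Main

variable {K : Type*} [Field K] [CharZero K] {q t : K}

lemma map_eulerSeries_mul_seriesA (ht0 : t ≠ 0) (hq : ∀ n : ℕ, 0 < n → q ^ n ≠ 1)
    (ht : ∀ n : ℕ, 0 < n → t ^ n ≠ 1) :
    PowerSeries.map (algebraMap K (Module.End K (SymFun K))) (eulerSeries t) * seriesA q t =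
      PowerSeries.mk fun k : ℕ => (t ^ k * qPoch t⁻¹ t⁻¹ k)⁻¹ • opS q t k := by
  ext1 n
  -- The truncation at `k ≤ b` is relaxed to the common bound `k ≤ n`, the added terms being zero,
  -- so that the sum over `k` can be moved outside the convolution.
  have hA (b : ℕ) (hb : b ≤ n) : PowerSeries.coeff b (seriesA q t) =
      ∑ k ∈ Finset.range (n + 1), PowerSeries.coeff b (invPoch t k) • opA q t k := by
    have hc (k : ℕ) : ((laurentPoch t k)⁻¹).coeff (b : ℤ) = PowerSeries.coeff b (invPoch t k) := by
      rw [inv_laurentPoch ht0, HahnSeries.ofPowerSeries_apply_coeff]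
    rw [seriesA, PowerSeries.coeff_mk]
    simp only [← hc]
    refine Finset.sum_subset (Finset.range_mono (by omega)) fun k _ hk => ?_
    rw [coeff_inv_laurentPoch ht0 (by simpa using hk), zero_smul]
  rw [PowerSeries.coeff_mul, PowerSeries.coeff_mk, opS_eq_sum_opA hq ht, Finset.smul_sum]
  have h1 : ∀ p ∈ Finset.HasAntidiagonal.antidiagonal n,
      PowerSeries.coeff p.1 (PowerSeries.map (algebraMap K (Module.End K (SymFun K)))
        (eulerSeries t)) * PowerSeries.coeff p.2 (seriesA q t) =
      ∑ k ∈ Finset.range (n + 1), (PowerSeries.coeff p.1 (eulerSeries t) *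
        PowerSeries.coeff p.2 (invPoch t k)) • opA q t k := by
    intro p hp
    have hp := Finset.HasAntidiagonal.mem_antidiagonal.1 hp
    rw [PowerSeries.coeff_map, ← Algebra.smul_def, hA _ (by omega), Finset.smul_sum]
    exact Finset.sum_congr rfl fun k _ => smul_smul _ _ _
  rw [Finset.sum_congr rfl h1, Finset.sum_comm]
  refine Finset.sum_congr rfl fun k hk => ?_
  rw [← Finset.sum_smul, ← PowerSeries.coeff_mul, coeff_eulerSeries_mul_invPoch ht0 ht
    (Nat.lt_succ_iff.1 (Finset.mem_range.1 hk)), smul_smul]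

end Main

end MacdonaldLax

open scoped PowerSeries.WithPiTopology in
open MacdonaldLax in
theorem mainTheorem3 :
    Multipliable (fun j : ℕ =>
      (1 - PowerSeries.C (tPar ^ j) * PowerSeries.X : PowerSeries QQqt)) ∧
    (∀ k : ℕ, PointwiseFinite fun l : PartitionOfLength k => termA qPar tPar l) ∧
    (∀ k : ℕ, PointwiseFinite fun mn : (Fin k → ℕ) × (Fin k → ℕ) =>
      termS qPar tPar mn.1 mn.2) ∧
    (PowerSeries.map (algebraMap QQqt (Module.End QQqt (SymFun QQqt))) (qPochInf tPar) *
        seriesA qPar tPar =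
      PowerSeries.mk fun k : ℕ =>
        (tPar ^ k * qPoch tPar⁻¹ tPar⁻¹ k)⁻¹ • opS qPar tPar k) ∧
    (∀ k : ℕ, opS qPar tPar k = ∑ i ∈ Finset.range (k + 1),
      (qPoch tPar tPar k / qPoch tPar tPar (k - i)) • opA qPar tPar i) := by
  refine ⟨hasProd_eulerSeries.multipliable,
    pointwiseFinite_termA qPar_pow_ne_one tPar_pow_ne_one,
    pointwiseFinite_termS qPar_pow_ne_one tPar_pow_ne_one, ?_,
    opS_eq_sum_opA qPar_pow_ne_one tPar_pow_ne_one⟩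
  rw [qPochInf_tPar]
  exact map_eulerSeries_mul_seriesA tPar_ne_zero qPar_pow_ne_one tPar_pow_ne_one
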